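/- Let $\mathcal M$ be a tetrahedral mesh in $\mathbb R^3$, i.e. a finite collection of nondegenerate tetrahedra any two of which are disjoint or meet exactly in a common vertex, edge or face; write $|\mathcal M|$ for the union of its tetrahedra and $P$ for the set of its vertices. Suppose that $\mathcal M$ is well-shaped with bound $\rho$: every tetrahedron $t$ of $\mathcal M$, with circumradius $R(t)$ and inradius $r(t)$, satisfies $R(t)/r(t)<\rho$. Let $\Omega$ be either the number $2\arcsin\frac{3\sqrt3}{8\rho^2}$ or the smallest solid angle at a vertex of a tetrahedron of $\mathcal M$ (or any positive lower bound for these solid angles), and let $$0\le\epsilon<\frac{1}{\rho^2+1}\left(\frac1\rho\right)^{\lfloor 2\pi/\Omega\rfloor+3}.$$ Let $q\in\mathbb R^3$, and let $\hat p\in P$ be a $(1+\epsilon)$-approximate nearest neighbour of $q$ in $P$, i.e. $|\hat pq|\le(1+\epsilon)|pq|$, where $p\in P$ is a nearest neighbour of $q$ in $P$. Assume that straight walks towards $q$ from within distance $|\hat pq|$ stay in the mesh: for every $z\in|\mathcal M|$ with $|zq|\le|\hat pq|$ the segment $zq$ is contained in $|\mathcal M|$ (so in particular $q\in|\mathcal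 M|$; this holds, for instance, if $|\mathcal M|$ is convex and contains $q$, or if the closed ball with centre $q$ and radius $|\hat pq|$ is contained in $|\mathcal M|$). Then the straight line walk from $\hat p$ to $q$ visits, i.e. the closed segment $\hat pq$ intersects, at most $$\frac{\sqrt3\,\pi}{486}\,\rho^3(\rho^2+3)^3+\left\lfloor\frac{2\pi}{\Omega}\right\rfloor$$ tetrahedra of $\mathcal M$. -/

import Mathlib

open MeasureTheory

noncomputable section

/-- Euclidean three-space. -/
abbrev E3 : Type := EuclideanSpace ℝ (Fin 3)

/-- A tetrahedral mesh in three-space: a finite geometric simplicial complex all of whose maximal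
simplices are (nondegenerate) tetrahedra. Simplices are represented by their vertex sets, and two
simplices meet in a common face or not at all. -/
structure IsTetrahedralMesh (M : Geometry.SimplicialComplex ℝ E3) : Prop where
  finite : M.faces.Finite
  pure : ∀ s ∈ M.facets, s.card = 4

/-- The tetrahedra of a mesh, each given by its set of four vertices. -/
def tetrahedra (M : Geometry.SimplicialComplex ℝ E3) : Set (Finset E3) :=
  {s | s ∈ M.faces ∧ s.card = 4}

/-- `t` is a tetrahedron of `M` (with its vertices listed in some order). -/
def IsTetrahedronOf (t : Affine.Simplex ℝ E3 3) (M : Geometry.SimplicialComplex ℝ E3) : Prop :=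
  ∃ s ∈ tetrahedra M, (s : Set E3) = Set.range t.points

/-- The mesh is well-shaped with bound `ρ`: the ratio of circumradius to inradius of each of its
tetrahedra is smaller than `ρ`. -/
def WellShaped (M : Geometry.SimplicialComplex ℝ E3) (ρ : ℝ) : Prop :=
  ∀ t : Affine.Simplex ℝ E3 3, IsTetrahedronOf t M → t.circumradius / t.inradius < ρ

/-- The solid angle of the tetrahedron `t` at its `i`-th vertex: the area of the set of unit
vectors that point from this vertex into the tetrahedron. -/
def solidAngle (t : Affine.Simplex ℝ E3 3) (i : Fin 4) : ℝ :=
  (volume : Measure E3).toSphere.real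
    {u : Metric.sphere (0 : E3) 1 |
      ∃ c : ℝ, 0 < c ∧ t.points i + c • (u : E3) ∈ convexHull ℝ (Set.range t.points)}

/-- `p` is a nearest neighbour of `q` among the points of `P`. -/
def IsNearestNeighbour (P : Set E3) (q p : E3) : Prop :=
  p ∈ P ∧ ∀ v ∈ P, dist p q ≤ dist v q

/-- `p'` is a `(1 + ε)`-approximate nearest neighbour of `q` among the points of `P`. -/
def IsApproxNearestNeighbour (P : Set E3) (ε : ℝ) (q p' : E3) : Prop :=
  p' ∈ P ∧ ∃ p, IsNearestNeighbour P q p ∧ dist p' q ≤ (1 + ε) * dist p q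

/-- The tetrahedra of `M` visited by the straight line walk from `a` to `q`: all those that the
closed segment from `a` to `q` meets, in whichever point. -/
def visitedTetrahedra (M : Geometry.SimplicialComplex ℝ E3) (a q : E3) : Set (Finset E3) :=
  {s | s ∈ tetrahedra M ∧ (segment ℝ a q ∩ convexHull ℝ (s : Set E3)).Nonempty}

end

/-! Let d₀ be the distance from q to the vertex set. The open ball of radius d₀ about q contains no
vertex, so a tetrahedron reaching into it is large: comparing the powers of a point z of it with
respect to q and to the circumcentre gives R² ≥ d₀² - |zq|² (`HasBalls.sq_sub_sq_le`). By the shape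
bound it then contains a large ball, so it has large volume and its barycentric coordinates vary
slowly, at rate at most 1/(2r).

Visited tetrahedra with vertex p' are counted by the volume of their disjoint cones
(`MeshBalls.card_le_of_mem`). For the others it is enough that the walk leaves its initial
tetrahedron at p' at a point of sufficient depth in the ball. From there on all circumradii exceed
some m comparable to the remaining length, and packing balls around the remaining segment bounds the
number of tetrahedra (`MeshBalls.card_le_of_le_R`, `MeshBalls.card_le_of_notMem`). Both counts
together fit into the first summand of the bound.

The heart is `MeshBalls.exists_initial_tetrahedron`: the tetrahedron b containing the point of the
walk at a certain depth Y below the sphere of radius d₀ can be chosen to have p' as a vertex. The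
proof walks outwards. Some vertex v of b has coordinate at least 1/4 at that point. Up to the sphere
the power bound limits the loss of this coordinate to 1/8. Beyond it there remains a length of at
most εd₀, on which radii are compared with that of b: tetrahedra at v linked by common faces have
circumradii of bounded ratio G (`MeshBalls.exists_growth`), and ε is small against 1/G. Hence the
coordinate of v is still at least 1/20 at p'; since p' is a vertex, v = p'. To cross only faces, the
walk ends at points near p' in general position; a closedness argument passes to p'.

The ratio G comes from counting tetrahedra at v if Ω bounds the solid angles, and from a volume
estimate for cones with edges of unequal length if Ω is the arcsine expression. -/

/-! ### Barycentric coordinates of a tetrahedron. -/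

/-- The finite set `s` is the vertex set of a nondegenerate tetrahedron. -/
def IsTet (s : Finset E3) : Prop := AffineIndependent ℝ ((↑) : s → E3) ∧ s.card = 4

/-- The affine basis formed by the vertices of a tetrahedron. -/
noncomputable def IsTet.basis {s : Finset E3} (h : IsTet s) : AffineBasis s ℝ E3 :=
  ⟨(↑), h.1, h.1.affineSpan_eq_top_iff_card_eq_finrank_add_one.2 (by simp [h.2])⟩

open Classical in
/-- The barycentric coordinate with respect to the vertex `v` of the tetrahedron `s`. -/
noncomputable def bary (s : Finset E3) (v : E3) : E3 →ᵃ[ℝ] ℝ :=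
  if h : IsTet s ∧ v ∈ s then h.1.basis.coord ⟨v, h.2⟩ else 0

theorem bary_eq_coord {s : Finset E3} (h : IsTet s) {v : E3} (hv : v ∈ s) :
    bary s v = h.basis.coord ⟨v, hv⟩ := by
  simp [bary, h, hv]

theorem bary_of_notMem {s : Finset E3} {v : E3} (hv : v ∉ s) : bary s v = 0 := by
  simp [bary, hv]

theorem IsTet.basis_apply {s : Finset E3} (h : IsTet s) (v : s) : h.basis v = v := rfl

theorem bary_self {s : Finset E3} (h : IsTet s) {v : E3} (hv : v ∈ s) : bary s v v = 1 := by
  rw [bary_eq_coord h hv]; exact h.basis.coord_apply_eq ⟨v, hv⟩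

theorem bary_of_ne {s : Finset E3} (h : IsTet s) {u v : E3} (hu : u ∈ s) (huv : u ≠ v) :
    bary s v u = 0 := by
  by_cases hv : v ∈ s
  · rw [bary_eq_coord h hv]
    exact h.basis.coord_apply_ne (i := ⟨v, hv⟩) (j := ⟨u, hu⟩) (by simpa using huv.symm)
  · simp [bary_of_notMem hv]

theorem sum_bary {s : Finset E3} (h : IsTet s) (z : E3) : ∑ v ∈ s, bary s v z = 1 := by
  rw [← Finset.sum_attach, ← h.basis.sum_coord_apply_eq_one z]
  exact Finset.sum_congr rfl fun v _ => by rw [bary_eq_coord h v.2]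

theorem sum_bary_smul {s : Finset E3} (h : IsTet s) (z : E3) : ∑ v ∈ s, bary s v z • v = z := by
  conv_rhs => rw [← h.basis.linear_combination_coord_eq_self z]
  rw [← Finset.sum_attach]
  exact Finset.sum_congr rfl fun v _ => by rw [bary_eq_coord h v.2, h.basis_apply]

theorem AffineMap.map_sum_smul {E F : Type*} [AddCommGroup E] [Module ℝ E] [AddCommGroup F]
    [Module ℝ F] (f : E →ᵃ[ℝ] F) (s : Finset E) (w : E → ℝ) (hw : ∑ v ∈ s, w v = 1) :
    f (∑ v ∈ s, w v • v) = ∑ v ∈ s, w v • f v := by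
  have := s.map_affineCombination (fun v : E => v) w hw f
  rw [Finset.affineCombination_eq_linear_combination _ _ _ hw,
    Finset.affineCombination_eq_linear_combination _ _ _ hw] at this
  simpa using this

theorem bary_sum_smul {s : Finset E3} (h : IsTet s) (w : E3 → ℝ) (hw : ∑ v ∈ s, w v = 1)
    {v : E3} (hv : v ∈ s) : bary s v (∑ u ∈ s, w u • u) = w v := by
  rw [AffineMap.map_sum_smul _ _ _ hw, Finset.sum_eq_single_of_mem v hv]
  · simp [bary_self h hv]
  · intro u hu huv
    simp [bary_of_ne h hu huv]

theorem IsTet.mem_convexHull_iff {s : Finset E3} (h : IsTet s) {z : E3} :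
    z ∈ convexHull ℝ (s : Set E3) ↔ ∀ v, 0 ≤ bary s v z := by
  constructor
  · intro hz v
    by_cases hv : v ∈ s
    · obtain ⟨w, hw0, hw1, rfl⟩ := Finset.mem_convexHull'.1 hz
      rw [bary_sum_smul h w hw1 hv]
      exact hw0 v hv
    · simp [bary_of_notMem hv]
  · intro hz
    exact Finset.mem_convexHull'.2 ⟨fun v => bary s v z, fun v _ => hz v, sum_bary h z,
      sum_bary_smul h z⟩

theorem bary_le_one {s : Finset E3} (h : IsTet s) {z : E3} (hz : z ∈ convexHull ℝ (s : Set E3))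
    (v : E3) : bary s v z ≤ 1 := by
  by_cases hv : v ∈ s
  · rw [← sum_bary h z]
    exact Finset.single_le_sum (f := fun v => bary s v z)
      (fun u _ => h.mem_convexHull_iff.1 hz u) hv
  · simp [bary_of_notMem hv]

/-- The gradient of a barycentric coordinate. -/
noncomputable def gradBary (s : Finset E3) (v : E3) : E3 :=
  (InnerProductSpace.toDual ℝ E3).symm (LinearMap.toContinuousLinearMap (bary s v).linear)

theorem inner_gradBary (s : Finset E3) (v x : E3) :
    inner ℝ (gradBary s v) x = (bary s v).linear x := by
  simp [gradBary, InnerProductSpace.toDual_symm_apply]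

theorem bary_sub (s : Finset E3) (v y z : E3) :
    bary s v y - bary s v z = inner ℝ (gradBary s v) (y - z) := by
  rw [inner_gradBary, ← vsub_eq_sub y z, AffineMap.linearMap_vsub, vsub_eq_sub]

theorem continuous_bary (s : Finset E3) (v : E3) : Continuous (bary s v) :=
  (bary s v).continuous_of_finiteDimensional

theorem bary_sub_le (s : Finset E3) (v y z : E3) :
    bary s v y - bary s v z ≤ ‖gradBary s v‖ * dist y z := by
  rw [bary_sub, dist_eq_norm]
  exact real_inner_le_norm _ _

/-! ### Inscribed balls, circumscribed spheres and gradients of barycentric coordinates. -/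

/-- `closedBall I r` is contained in the tetrahedron `s` and the sphere with centre `O` and radius
`R` contains its vertices. -/
structure HasBalls (s : Finset E3) (I O : E3) (r R : ℝ) : Prop where
  isTet : IsTet s
  r_pos : 0 < r
  ball_subset : Metric.closedBall I r ⊆ convexHull ℝ (s : Set E3)
  dist_eq : ∀ v ∈ s, dist v O = R

namespace HasBalls

variable {s : Finset E3} {I O : E3} {r R : ℝ}

/-- An affine function with values in [0, 1] on the ball attains its extremes there at distance `r`
from `I` along its gradient. -/
theorem gradBary_mul_le (h : HasBalls s I O r R) (v : E3) :
    r * ‖gradBary s v‖ ≤ bary s v I ∧ bary s v I + r * ‖gradBary s v‖ ≤ 1 := by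
  have hI : I ∈ convexHull ℝ (s : Set E3) :=
    h.ball_subset (Metric.mem_closedBall_self h.r_pos.le)
  rcases eq_or_ne (gradBary s v) 0 with h0 | h0
  · simp only [h0, norm_zero, mul_zero, add_zero]
    exact ⟨h.isTet.mem_convexHull_iff.1 hI v, bary_le_one h.isTet hI v⟩
  have hn : 0 < ‖gradBary s v‖ := norm_pos_iff.2 h0
  set e : E3 := (r / ‖gradBary s v‖) • gradBary s v with he
  have hne : ‖e‖ = r := by
    rw [he, norm_smul, Real.norm_of_nonneg (div_nonneg h.r_pos.le hn.le), div_mul_cancel₀ _ hn.ne']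
  have hin : inner ℝ (gradBary s v) e = r * ‖gradBary s v‖ := by
    rw [he, inner_smul_right, real_inner_self_eq_norm_sq]; field_simp
  have h1 : I - e ∈ convexHull ℝ (s : Set E3) := h.ball_subset (by simp [hne])
  have h2 : I + e ∈ convexHull ℝ (s : Set E3) := h.ball_subset (by simp [hne])
  have h3 := h.isTet.mem_convexHull_iff.1 h1 v
  have h4 := bary_le_one h.isTet h2 v
  have h5 := bary_sub s v I (I - e)
  have h6 := bary_sub s v (I + e) I
  rw [sub_sub_cancel, hin] at h5
  rw [add_sub_cancel_left, hin] at h6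
  constructor <;> linarith

theorem two_mul_gradBary_le (h : HasBalls s I O r R) (v : E3) :
    2 * r * ‖gradBary s v‖ ≤ 1 := by
  have := h.gradBary_mul_le v
  linarith [this.1, this.2]

theorem sum_gradBary_le (h : HasBalls s I O r R) : r * ∑ v ∈ s, ‖gradBary s v‖ ≤ 1 := by
  rw [Finset.mul_sum, ← sum_bary h.isTet I]
  exact Finset.sum_le_sum fun v _ => (h.gradBary_mul_le v).1

theorem bary_sub_le (h : HasBalls s I O r R) (v y z : E3) :
    bary s v y - bary s v z ≤ dist y z / (2 * r) := by
  have hr := h.r_pos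
  refine (_root_.bary_sub_le s v y z).trans ?_
  rw [le_div_iff₀ (by positivity)]
  nlinarith [h.two_mul_gradBary_le v, dist_nonneg (x := y) (y := z)]

theorem R_pos (h : HasBalls s I O r R) : 0 < R := by
  obtain ⟨u, hu, v, hv, huv⟩ := Finset.one_lt_card.1 (by rw [h.isTet.2]; norm_num)
  by_contra hR
  have h1 := h.dist_eq u hu
  have h2 := h.dist_eq v hv
  have h3 := dist_triangle_right u v O
  have := dist_pos.2 huv
  linarith

theorem dist_le (h : HasBalls s I O r R) {u v : E3} (hu : u ∈ s) (hv : v ∈ s) :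
    dist u v ≤ 2 * R := by
  have := dist_triangle_right u v O
  rw [h.dist_eq u hu, h.dist_eq v hv] at this
  linarith

theorem one_le_gradBary_mul_dist (h : HasBalls s I O r R) {u v : E3} (hu : u ∈ s) (hv : v ∈ s)
    (huv : u ≠ v) : 1 ≤ ‖gradBary s u‖ * dist u v := by
  have := _root_.bary_sub_le s u u v
  rwa [bary_self h.isTet hu, bary_of_ne h.isTet hv huv.symm, sub_zero] at this

theorem two_mul_r_le_dist (h : HasBalls s I O r R) {u v : E3} (hu : u ∈ s) (hv : v ∈ s)
    (huv : u ≠ v) : 2 * r ≤ dist u v := by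
  have h1 := h.bary_sub_le u u v
  rw [bary_self h.isTet hu, bary_of_ne h.isTet hv huv.symm, sub_zero,
    le_div_iff₀ (by have := h.r_pos; positivity)] at h1
  linarith

/-- The distance of two vertices is bounded below by the radii. -/
theorem two_mul_R_mul_r_le (h : HasBalls s I O r R) {u v : E3} (hu : u ∈ s) (hv : v ∈ s)
    (huv : u ≠ v) : 2 * R * r ≤ (R - r) * dist u v := by
  classical
  have hR := h.R_pos
  have hr := h.r_pos
  have hd := dist_pos.2 huv
  have h1 := h.sum_gradBary_le
  -- The gradient norms are the reciprocal heights. The heights from `u` and `v` are at most `dist u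
  -- v`, the other two at most the diameter of the circumsphere.
  have key : ∑ w ∈ s, (if w = u ∨ w = v then 1 / dist u v else 1 / (2 * R)) ≤
      ∑ w ∈ s, ‖gradBary s w‖ := by
    refine Finset.sum_le_sum fun w hw => ?_
    split_ifs with hc
    · rw [div_le_iff₀ hd]
      rcases hc with rfl | rfl
      · exact h.one_le_gradBary_mul_dist hw hv huv
      · rw [dist_comm]; exact h.one_le_gradBary_mul_dist hw hu huv.symm
    · push Not at hc
      rw [div_le_iff₀ (by positivity)]
      refine (h.one_le_gradBary_mul_dist hw hu hc.1).trans ?_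
      gcongr
      exact h.dist_le hw hu
  have hcard : ({w ∈ s | w = u ∨ w = v} : Finset E3) = {u, v} := by
    ext w; simp only [Finset.mem_filter, Finset.mem_insert, Finset.mem_singleton]
    constructor
    · exact fun h => h.2
    · rintro (rfl | rfl) <;> simp [*]
  have hcard1 := Finset.card_filter_add_card_filter_not (s := s) (fun w => w = u ∨ w = v)
  rw [hcard, Finset.card_pair huv, h.isTet.2] at hcard1
  rw [Finset.sum_ite, Finset.sum_const, Finset.sum_const, hcard, Finset.card_pair huv,
    show ({w ∈ s | ¬(w = u ∨ w = v)} : Finset E3).card = 2 by omega] at key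
  have h2 := (mul_le_mul_of_nonneg_left key hr.le).trans h1
  simp only [nsmul_eq_mul, Nat.cast_ofNat] at h2
  have h3 : r * (2 * (1 / dist u v) + 2 * (1 / (2 * R))) = (2 * R * r + r * dist u v) / (R * dist u v) := by
    field_simp
  rw [h3, div_le_one (by positivity)] at h2
  linarith

/-- At the circumcentre each coordinate has dropped from 1 by at most `R` times its gradient norm.
The four drops add up to 4 - 1 = 3, while the gradient norms add up to at most 1 / r. -/
theorem three_mul_r_le (h : HasBalls s I O r R) : 3 * r ≤ R := by
  have h1 := h.sum_gradBary_le
  have key : ∑ v ∈ s, (1 - bary s v O) ≤ ∑ v ∈ s, ‖gradBary s v‖ * R := by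
    refine Finset.sum_le_sum fun v hv => ?_
    have := _root_.bary_sub_le s v v O
    rwa [bary_self h.isTet hv, h.dist_eq v hv] at this
  rw [Finset.sum_sub_distrib, sum_bary h.isTet, Finset.sum_const, h.isTet.2, ← Finset.sum_mul] at key
  norm_num at key
  nlinarith [h.R_pos, h.r_pos]

theorem convexHull_subset (h : HasBalls s I O r R) :
    convexHull ℝ (s : Set E3) ⊆ Metric.closedBall O R :=
  convexHull_min (fun v hv => (h.dist_eq v hv).le) (convex_closedBall O R)

theorem dist_le_of_mem (h : HasBalls s I O r R) {y z : E3} (hy : y ∈ convexHull ℝ (s : Set E3))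
    (hz : z ∈ convexHull ℝ (s : Set E3)) : dist y z ≤ 2 * R := by
  have h1 := h.convexHull_subset hy
  have h2 := h.convexHull_subset hz
  rw [Metric.mem_closedBall] at h1 h2
  linarith [dist_triangle_right y z O]

/-- If the vertices of `s` are outside of a ball, then the depth of the points of `s` in this ball
is controlled by the circumradius. -/
theorem sq_sub_sq_le (h : HasBalls s I O r R) {q z : E3} {d : ℝ} (hd : 0 ≤ d)
    (hq : ∀ v ∈ s, d ≤ dist v q) (hz : z ∈ convexHull ℝ (s : Set E3)) :
    d ^ 2 - dist z q ^ 2 ≤ R ^ 2 := by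
  have hw := h.isTet.mem_convexHull_iff.1 hz
  -- The parallel axis identity. Its last sum does not depend on `c`, so the cases `c = q` and `c =
  -- O` can be subtracted.
  have expand : ∀ c : E3, ∑ v ∈ s, bary s v z * dist v c ^ 2 =
      dist z c ^ 2 + ∑ v ∈ s, bary s v z * dist v z ^ 2 := by
    intro c
    have h1 : ∀ v ∈ s, bary s v z * dist v c ^ 2 = bary s v z * dist z c ^ 2 +
        bary s v z * dist v z ^ 2 + 2 * inner ℝ (bary s v z • v - bary s v z • z) (z - c) := by
      intro v _
      rw [← smul_sub, inner_smul_left, dist_eq_norm, dist_eq_norm, dist_eq_norm,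
        ← sub_add_sub_cancel v z c, @norm_add_sq_real]
      simp only [conj_trivial]
      ring
    rw [Finset.sum_congr rfl h1, Finset.sum_add_distrib, Finset.sum_add_distrib, ← Finset.sum_mul,
      sum_bary h.isTet, ← Finset.mul_sum, ← sum_inner, Finset.sum_sub_distrib,
      sum_bary_smul h.isTet, ← Finset.sum_smul, sum_bary h.isTet]
    simp
  have h1 := expand q
  have h2 := expand O
  have h3 : d ^ 2 ≤ ∑ v ∈ s, bary s v z * dist v q ^ 2 := by
    calc d ^ 2 = ∑ v ∈ s, bary s v z * d ^ 2 := by rw [← Finset.sum_mul, sum_bary h.isTet, one_mul]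
      _ ≤ _ := Finset.sum_le_sum fun v hv =>
        mul_le_mul_of_nonneg_left (pow_le_pow_left₀ hd (hq v hv) 2) (hw v)
  have h4 : ∑ v ∈ s, bary s v z * dist v O ^ 2 = R ^ 2 := by
    rw [Finset.sum_congr rfl fun v hv => by rw [h.dist_eq v hv], ← Finset.sum_mul,
      sum_bary h.isTet, one_mul]
  nlinarith [sq_nonneg (dist z O)]

end HasBalls

/-- The balls of a tetrahedron given by its incentre and circumcentre. -/
theorem Affine.Simplex.hasBalls (t : Affine.Simplex ℝ E3 3) {s : Finset E3}
    (hs : (s : Set E3) = Set.range t.points) :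
    HasBalls s t.incenter t.circumcenter t.inradius t.circumradius := by
  classical
  have hs' : s = Finset.univ.image t.points := by
    ext x; rw [← Finset.mem_coe, hs]; simp
  have hcard : s.card = 4 := by
    rw [hs', Finset.card_image_of_injective _ t.independent.injective]; simp
  have hind : AffineIndependent ℝ ((↑) : s → E3) := by
    have := t.independent.range
    rw [← hs] at this
    exact this
  have htet : IsTet s := ⟨hind, hcard⟩
  refine ⟨htet, t.inradius_pos, fun y hy => htet.mem_convexHull_iff.2 fun v => ?_, ?_⟩
  · by_cases hv : v ∈ s
    swap
    · simp [bary_of_notMem hv]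
    obtain ⟨i, rfl⟩ : ∃ i, t.points i = v := by
      have : v ∈ (s : Set E3) := hv
      rwa [hs] at this
    -- The signed distance to a face is the height times the barycentric coordinate, so
    -- nonnegativity of one is that of the other.
    have hsd : t.signedInfDist i y = bary s (t.points i) y * t.signedInfDist i (t.points i) := by
      conv_lhs => rw [← sum_bary_smul htet y]
      have := AffineMap.map_sum_smul (t.signedInfDist i).toAffineMap s (fun v => bary s v y)
        (sum_bary htet y)
      refine this.trans ?_
      rw [Finset.sum_eq_single_of_mem (t.points i) hv]
      · rfl
      · intro u hu hui
        obtain ⟨j, rfl⟩ : ∃ j, t.points j = u := by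
          have : u ∈ (s : Set E3) := hu
          rwa [hs] at this
        have hji : j ≠ i := fun h => hui (by rw [h])
        have : t.signedInfDist i (t.points j) = 0 := t.signedInfDist_apply_of_ne hji
        simp [this]
    have hpos : 0 < t.signedInfDist i (t.points i) := by
      rw [t.signedInfDist_apply_self]
      exact t.height_pos i
    have hI := t.signedInfDist_incenter i
    have hlip : |t.signedInfDist i y - t.signedInfDist i t.incenter| ≤ dist y t.incenter := by
      rw [Affine.Simplex.signedInfDist, AffineSubspace.signedInfDist_def, signedDist_triangle_left,
        dist_comm]
      exact abs_signedDist_le_dist _ _ _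
    have := (abs_le.1 hlip).1
    rw [Metric.mem_closedBall] at hy
    by_contra hneg
    push Not at hneg
    nlinarith
  · intro v hv
    obtain ⟨i, rfl⟩ : ∃ i, t.points i = v := by
      have : v ∈ (s : Set E3) := hv
      rwa [hs] at this
    exact t.dist_circumcenter_eq_circumradius i

/-! ### Meshes, and how their tetrahedra meet. -/

/-- A tetrahedral mesh with chosen balls contained in its tetrahedra and spheres through their
vertices, such that the ratios of the radii are smaller than `ρ`. -/
structure MeshBalls (M : Geometry.SimplicialComplex ℝ E3) (ρ : ℝ) (I O : Finset E3 → E3)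
    (r R : Finset E3 → ℝ) : Prop where
  mesh : IsTetrahedralMesh M
  balls : ∀ s ∈ tetrahedra M, HasBalls s (I s) (O s) (r s) (R s)
  lt : ∀ s ∈ tetrahedra M, R s < ρ * r s

/-- Every tetrahedron of a mesh is the range of the points of an affine simplex. -/
theorem exists_simplex_of_isTet {s : Finset E3} (h : IsTet s) :
    ∃ t : Affine.Simplex ℝ E3 3, (s : Set E3) = Set.range t.points := by
  let e : Fin 4 ≃ s := (s.equivFinOfCardEq h.2).symm
  refine ⟨⟨fun i => e i, h.1.comp_embedding e.toEmbedding⟩, ?_⟩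
  ext x
  constructor
  · intro hx
    exact ⟨e.symm ⟨x, hx⟩, by simp⟩
  · rintro ⟨i, rfl⟩
    exact (e i).2

theorem IsTet.of_mem {M : Geometry.SimplicialComplex ℝ E3} {s : Finset E3}
    (hs : s ∈ tetrahedra M) : IsTet s := ⟨M.indep hs.1, hs.2⟩

theorem WellShaped.exists_meshBalls {M : Geometry.SimplicialComplex ℝ E3} {ρ : ℝ}
    (hM : IsTetrahedralMesh M) (hρ : WellShaped M ρ) : ∃ I O r R, MeshBalls M ρ I O r R := by
  have : ∀ s : Finset E3, ∃ (I O : E3) (r R : ℝ), s ∈ tetrahedra M →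
      HasBalls s I O r R ∧ R < ρ * r := by
    intro s
    by_cases hs : s ∈ tetrahedra M
    · obtain ⟨t, ht⟩ := exists_simplex_of_isTet (IsTet.of_mem hs)
      refine ⟨_, _, _, _, fun _ => ⟨t.hasBalls ht, ?_⟩⟩
      rw [← div_lt_iff₀ t.inradius_pos]
      exact hρ t ⟨s, hs, ht⟩
    · exact ⟨0, 0, 0, 0, fun h => absurd h hs⟩
  choose I O r R h using this
  exact ⟨I, O, r, R, hM, fun s hs => (h s hs).1, fun s hs => (h s hs).2⟩

theorem IsTetrahedralMesh.finite_tetrahedra {M : Geometry.SimplicialComplex ℝ E3}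
    (hM : IsTetrahedralMesh M) : (tetrahedra M).Finite := hM.finite.subset fun _ hs => hs.1

theorem IsTetrahedralMesh.exists_tetrahedron_superset {M : Geometry.SimplicialComplex ℝ E3}
    (hM : IsTetrahedralMesh M) {f : Finset E3} (hf : f ∈ M.faces) :
    ∃ s ∈ tetrahedra M, f ⊆ s := by
  obtain ⟨s, hfs, hs⟩ := hM.finite.exists_le_maximal hf
  have hs' : s ∈ M.facets := ⟨hs.1, fun t ht hst => (hs.eq_of_le ht hst)⟩
  exact ⟨s, ⟨hs.1, hM.pure s hs'⟩, hfs⟩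

theorem IsTetrahedralMesh.mem_space_iff {M : Geometry.SimplicialComplex ℝ E3}
    (hM : IsTetrahedralMesh M) {z : E3} :
    z ∈ M.space ↔ ∃ s ∈ tetrahedra M, z ∈ convexHull ℝ (s : Set E3) := by
  rw [Geometry.SimplicialComplex.mem_space_iff]
  constructor
  · rintro ⟨f, hf, hz⟩
    obtain ⟨s, hs, hfs⟩ := hM.exists_tetrahedron_superset hf
    exact ⟨s, hs, convexHull_mono hfs hz⟩
  · rintro ⟨s, hs, hz⟩
    exact ⟨s, hs.1, hz⟩

theorem mem_vertices_of_mem {M : Geometry.SimplicialComplex ℝ E3} {s : Finset E3}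
    (hs : s ∈ tetrahedra M) {v : E3} (hv : v ∈ s) : v ∈ M.vertices := by
  rw [Geometry.SimplicialComplex.vertices_eq]
  exact Set.mem_biUnion hs.1 hv

theorem IsTetrahedralMesh.finite_vertices {M : Geometry.SimplicialComplex ℝ E3}
    (hM : IsTetrahedralMesh M) : M.vertices.Finite := by
  rw [Geometry.SimplicialComplex.vertices_eq]
  exact hM.finite.biUnion fun s _ => s.finite_toSet

open Classical in
theorem mem_convexHull_inter {M : Geometry.SimplicialComplex ℝ E3} {s t : Finset E3}
    (hs : s ∈ tetrahedra M) (ht : t ∈ tetrahedra M) {z : E3}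
    (hzs : z ∈ convexHull ℝ (s : Set E3)) (hzt : z ∈ convexHull ℝ (t : Set E3)) :
    z ∈ convexHull ℝ ((s ∩ t : Finset E3) : Set E3) := by
  rw [Finset.coe_inter]
  exact M.inter_subset_convexHull hs.1 ht.1 ⟨hzs, hzt⟩

/-- The barycentric coordinates of a point do not depend on the tetrahedron of the mesh. -/
theorem bary_eq_bary {M : Geometry.SimplicialComplex ℝ E3} {s t : Finset E3}
    (hs : s ∈ tetrahedra M) (ht : t ∈ tetrahedra M) {z : E3}
    (hzs : z ∈ convexHull ℝ (s : Set E3)) (hzt : z ∈ convexHull ℝ (t : Set E3)) (v : E3) :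
    bary s v z = bary t v z := by
  classical
  obtain ⟨w, -, hw1, hwz⟩ := Finset.mem_convexHull'.1 (mem_convexHull_inter hs ht hzs hzt)
  -- The point is a combination of the common vertices; extended by zero, its weights are the
  -- coordinates in either tetrahedron.
  have key : ∀ a ∈ tetrahedra M, s ∩ t ⊆ a → bary a v z = if v ∈ s ∩ t then w v else 0 := by
    intro a ha hsub
    by_cases hv : v ∈ a
    · have h1 : ∑ u ∈ a, (if u ∈ s ∩ t then w u else 0) = 1 := by
        rw [← hw1, ← Finset.sum_subset hsub]
        · exact Finset.sum_congr rfl fun u hu => by simp [hu]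
        · intro u _ hu; simp [hu]
      have h2 : ∑ u ∈ a, (if u ∈ s ∩ t then w u else 0) • u = z := by
        rw [← hwz, ← Finset.sum_subset hsub]
        · exact Finset.sum_congr rfl fun u hu => by simp [hu]
        · intro u _ hu; simp [hu]
      have := bary_sum_smul (IsTet.of_mem ha) _ h1 hv
      rwa [h2] at this
    · rw [bary_of_notMem hv, if_neg fun h => hv (hsub h)]; rfl
  rw [key s hs Finset.inter_subset_left, key t ht Finset.inter_subset_right]

theorem mem_of_bary_ne_zero {s : Finset E3} {v z : E3} (h : bary s v z ≠ 0) : v ∈ s := by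
  by_contra hv
  exact h (by simp [bary_of_notMem hv])

open Classical in
/-- Tetrahedra that meet in a point of no edge of the mesh have three common vertices. -/
theorem three_le_card_inter {M : Geometry.SimplicialComplex ℝ E3} {s t : Finset E3}
    (hs : s ∈ tetrahedra M) (ht : t ∈ tetrahedra M) {z : E3}
    (hzs : z ∈ convexHull ℝ (s : Set E3)) (hzt : z ∈ convexHull ℝ (t : Set E3))
    (hz : ∀ u ∈ M.vertices, ∀ w ∈ M.vertices, z ∉ affineSpan ℝ {u, w}) :
    3 ≤ (s ∩ t).card := by
  by_contra hlt
  have hmem := mem_convexHull_inter hs ht hzs hzt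
  have hne : (s ∩ t).Nonempty := by
    have := (convexHull_nonempty_iff.1 ⟨z, hmem⟩)
    exact Finset.coe_nonempty.1 this
  have hsub : ∀ x ∈ s ∩ t, x ∈ M.vertices := fun x hx =>
    mem_vertices_of_mem hs (Finset.mem_inter.1 hx).1
  have hcases : ∃ u w, s ∩ t = {u, w} := by
    have h2 : (s ∩ t).card = 1 ∨ (s ∩ t).card = 2 := by
      have := hne.card_pos
      omega
    rcases h2 with h | h
    · obtain ⟨u, hu⟩ := Finset.card_eq_one.1 h
      exact ⟨u, u, by simpa using hu⟩
    · obtain ⟨u, w, -, hu⟩ := Finset.card_eq_two.1 h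
      exact ⟨u, w, hu⟩
  obtain ⟨u, w, huw⟩ := hcases
  rw [huw] at hmem hsub
  refine hz u (hsub u (by simp)) w (hsub w (by simp)) ?_
  have := convexHull_subset_affineSpan (𝕜 := ℝ) _ hmem
  simpa using this

open Classical in
theorem volume_affineSpan_inter_eq_zero {s t : Finset E3} (hs : IsTet s) (ht : IsTet t) (hst : s ≠ t) :
    volume (affineSpan ℝ ((s ∩ t : Finset E3) : Set E3) : Set E3) = 0 := by
  refine Measure.addHaar_affineSubspace _ _ fun htop => hst ?_
  have hind : AffineIndependent ℝ ((↑) : (s ∩ t : Finset E3) → E3) :=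
    hs.1.mono (by intro x hx; simp at hx ⊢; exact hx.1)
  have := (hind.affineSpan_eq_top_iff_card_eq_finrank_add_one).1 (by rw [Subtype.range_coe]; exact htop)
  simp only [Fintype.card_coe, finrank_euclideanSpace, Fintype.card_fin] at this
  have h1 : s ∩ t = s := Finset.eq_of_subset_of_card_le Finset.inter_subset_left (by rw [hs.2, this])
  have h2 : s ∩ t = t := Finset.eq_of_subset_of_card_le Finset.inter_subset_right (by rw [ht.2, this])
  rw [← h1, h2]

theorem aedisjoint_convexHull {M : Geometry.SimplicialComplex ℝ E3} {s t : Finset E3}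
    (hs : s ∈ tetrahedra M) (ht : t ∈ tetrahedra M) (hst : s ≠ t) :
    AEDisjoint volume (convexHull ℝ (s : Set E3)) (convexHull ℝ (t : Set E3)) := by
  classical
  refine measure_mono_null ?_ (volume_affineSpan_inter_eq_zero (IsTet.of_mem hs) (IsTet.of_mem ht) hst)
  rintro z ⟨hzs, hzt⟩
  exact convexHull_subset_affineSpan _ (mem_convexHull_inter hs ht hzs hzt)

namespace MeshBalls

variable {M : Geometry.SimplicialComplex ℝ E3} {ρ : ℝ} {I O : Finset E3 → E3}
  {r R : Finset E3 → ℝ}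

theorem three_lt (h : MeshBalls M ρ I O r R) {s : Finset E3} (hs : s ∈ tetrahedra M) : 3 < ρ := by
  have h1 := (h.balls s hs).three_mul_r_le
  have h2 := h.lt s hs
  have h3 := (h.balls s hs).r_pos
  by_contra hρ
  push Not at hρ
  nlinarith

/-- The common edge is at most the diameter of the circumsphere of `t` and bounded below by the
radii of `s`. The factor `R - r` in that lower bound improves `ρ` to `ρ - 1`. -/
theorem R_le_of_edge (h : MeshBalls M ρ I O r R) {s t : Finset E3} (hs : s ∈ tetrahedra M)
    (ht : t ∈ tetrahedra M) {u v : E3} (hus : u ∈ s) (hvs : v ∈ s) (hut : u ∈ t) (hvt : v ∈ t)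
    (huv : u ≠ v) : R s ≤ (ρ - 1) * R t := by
  have hs' := h.balls s hs
  have h1 := hs'.two_mul_R_mul_r_le hus hvs huv
  have h2 := (h.balls t ht).dist_le hut hvt
  have h3 := h.lt s hs
  have h4 : (R s - r s) * dist u v ≤ ((ρ - 1) * r s) * (2 * R t) := by
    have := hs'.three_mul_r_le
    have := hs'.r_pos
    apply mul_le_mul (by linarith) h2 dist_nonneg (by nlinarith)
  have h5 : r s * (2 * R s) ≤ r s * (2 * ((ρ - 1) * R t)) := by linarith
  linarith [le_of_mul_le_mul_left h5 hs'.r_pos]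

end MeshBalls

/-! ### Cones at a vertex, solid angles, and counting by volume. -/

theorem sum_measureReal_le {ι : Type*} {S : Finset ι} {A : ι → Set E3} {B : Set E3}
    (hd : ∀ i ∈ S, ∀ j ∈ S, i ≠ j → AEDisjoint volume (A i) (A j))
    (hm : ∀ i ∈ S, NullMeasurableSet (A i) volume) (hsub : ∀ i ∈ S, A i ⊆ B)
    (hB : volume B ≠ ⊤) : ∑ i ∈ S, volume.real (A i) ≤ volume.real B := by
  have h1 : volume (⋃ i ∈ S, A i) = ∑ i ∈ S, volume (A i) :=
    measure_biUnion_finset₀ (fun i hi j hj hij => hd i hi j hj hij) hm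
  have h2 : volume (⋃ i ∈ S, A i) ≤ volume B :=
    measure_mono (Set.iUnion₂_subset hsub)
  rw [h1] at h2
  have h3 := ENNReal.toReal_mono hB h2
  rwa [ENNReal.toReal_sum fun i hi => ne_top_of_le_ne_top hB (measure_mono (hsub i hi))] at h3

/-- The cone of the directions that point from `v` into the convex hull of `s`. -/
def coneAt (s : Finset E3) (v : E3) : Set E3 :=
  {x | ∃ c : ℝ, 0 < c ∧ v + c • x ∈ convexHull ℝ (s : Set E3)}

theorem add_smul_mem_of_le {s : Finset E3} {v x : E3} (hv : v ∈ s) {b c : ℝ} (hb : 0 < b)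
    (hbc : b ≤ c) (hc : v + c • x ∈ convexHull ℝ (s : Set E3)) :
    v + b • x ∈ convexHull ℝ (s : Set E3) := by
  have hc0 : 0 < c := hb.trans_le hbc
  have hseg := (convex_convexHull ℝ (s : Set E3)) (subset_convexHull ℝ _ hv) hc
    (sub_nonneg.2 ((div_le_one hc0).2 hbc)) (div_nonneg hb.le hc0.le) (by ring)
  convert hseg using 1
  rw [smul_add, smul_smul, div_mul_cancel₀ _ hc0.ne', ← add_assoc, ← add_smul]
  simp

theorem smul_mem_coneAt {s : Finset E3} {v x : E3} (hx : x ∈ coneAt s v) {a : ℝ} (ha : 0 < a) :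
    a • x ∈ coneAt s v := by
  obtain ⟨c, hc, h⟩ := hx
  refine ⟨c / a, div_pos hc ha, ?_⟩
  rwa [smul_smul, div_mul_cancel₀ _ ha.ne']

theorem measurableSet_coneAt {s : Finset E3} {v : E3} (hv : v ∈ s) :
    MeasurableSet (coneAt s v) := by
  have : coneAt s v =
      ⋃ n : ℕ, (fun x : E3 => v + (1 / ((n : ℝ) + 1)) • x) ⁻¹' convexHull ℝ (s : Set E3) := by
    ext x
    simp only [Set.mem_iUnion, Set.mem_preimage]
    constructor
    · rintro ⟨c, hc, h⟩
      obtain ⟨n, hn⟩ := exists_nat_one_div_lt hc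
      exact ⟨n, add_smul_mem_of_le hv (by positivity) hn.le h⟩
    · rintro ⟨n, h⟩
      exact ⟨_, by positivity, h⟩
  rw [this]
  refine MeasurableSet.iUnion fun n => ?_
  have hcl : IsClosed (convexHull ℝ (s : Set E3)) :=
    s.finite_toSet.isClosed_convexHull ℝ
  exact (hcl.preimage (by fun_prop)).measurableSet

/-- A direction in both cones has a short multiple that stays in both tetrahedra, hence it points
into the affine span of the common vertices, a null set. -/
theorem aedisjoint_coneAt {M : Geometry.SimplicialComplex ℝ E3} {s t : Finset E3} {v : E3}
    (hs : s ∈ tetrahedra M) (ht : t ∈ tetrahedra M) (hvs : v ∈ s) (hvt : v ∈ t) (hst : s ≠ t) :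
    AEDisjoint volume (coneAt s v) (coneAt t v) := by
  classical
  have h0 := volume_affineSpan_inter_eq_zero (IsTet.of_mem hs) (IsTet.of_mem ht) hst
  have h1 : volume ((fun x : E3 => v + x) ⁻¹'
      (affineSpan ℝ ((s ∩ t : Finset E3) : Set E3) : Set E3)) = 0 := by
    rw [measure_preimage_add]; exact h0
  refine measure_mono_null ?_ h1
  rintro x ⟨⟨b, hb, hbs⟩, ⟨c, hc, hct⟩⟩
  have hm : 0 < min b c := lt_min hb hc
  have hmem := convexHull_subset_affineSpan (𝕜 := ℝ) _
    (mem_convexHull_inter hs ht (add_smul_mem_of_le hvs hm (min_le_left _ _) hbs)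
      (add_smul_mem_of_le hvt hm (min_le_right _ _) hct))
  have hv : v ∈ affineSpan ℝ ((s ∩ t : Finset E3) : Set E3) :=
    subset_affineSpan _ _ (by simp [hvs, hvt])
  have := AffineMap.lineMap_mem (1 / min b c) hv hmem
  rw [AffineMap.lineMap_apply] at this
  simpa [smul_smul, hm.ne', add_comm] using this

theorem volume_real_ball (x : E3) {c : ℝ} (hc : 0 ≤ c) :
    volume.real (Metric.ball x c) = c ^ 3 * (Real.pi * 4 / 3) := by
  rw [measureReal_def, EuclideanSpace.volume_ball_fin_three, ENNReal.toReal_mul, ENNReal.toReal_pow,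
    ENNReal.toReal_ofReal hc, ENNReal.toReal_ofReal (by positivity)]

theorem volume_real_closedBall (x : E3) {c : ℝ} (hc : 0 ≤ c) :
    volume.real (Metric.closedBall x c) = c ^ 3 * (Real.pi * 4 / 3) := by
  rw [← volume_real_ball x hc, measureReal_def, measureReal_def,
    Measure.addHaar_closedBall_eq_addHaar_ball]

open scoped Pointwise in
theorem solidAngle_eq {s : Finset E3} {t : Affine.Simplex ℝ E3 3}
    (hs : (s : Set E3) = Set.range t.points) (i : Fin 4) :
    solidAngle t i = 3 * volume.real (coneAt s (t.points i) ∩ Metric.ball 0 1) := by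
  have hv : t.points i ∈ s := by rw [← Finset.mem_coe, hs]; exact Set.mem_range_self i
  set S : Set (Metric.sphere (0 : E3) 1) := {u | ∃ c : ℝ, 0 < c ∧
    t.points i + c • (u : E3) ∈ convexHull ℝ (Set.range t.points)} with hS
  have hS' : S = Subtype.val ⁻¹' coneAt s (t.points i) := by
    ext u; simp [hS, coneAt, hs]
  have hmeas : MeasurableSet S := by
    rw [hS']; exact measurable_subtype_coe (measurableSet_coneAt hv)
  have himg : Set.Ioo (0 : ℝ) 1 • ((↑) '' S : Set E3) =
      (coneAt s (t.points i) ∩ Metric.ball 0 1) \ {0} := by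
    ext x
    constructor
    · rintro ⟨a, ha, _, ⟨u, hu, rfl⟩, rfl⟩
      rw [hS'] at hu
      have hu1 : ‖(u : E3)‖ = 1 := by simp
      refine ⟨⟨smul_mem_coneAt hu ha.1, ?_⟩, ?_⟩
      · simp [norm_smul, hu1, abs_of_pos ha.1, ha.2]
      · have : (u : E3) ≠ 0 := fun h => by simp [h] at hu1
        simp [ha.1.ne', this]
    · rintro ⟨⟨hx, hx1⟩, hx0⟩
      have hx0 : x ≠ 0 := hx0
      have hn : 0 < ‖x‖ := norm_pos_iff.2 hx0
      have hun : ‖(‖x‖⁻¹ • x : E3)‖ = 1 := by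
        rw [norm_smul, norm_inv, norm_norm, inv_mul_cancel₀ hn.ne']
      refine ⟨‖x‖, ⟨hn, by simpa using hx1⟩, ‖x‖⁻¹ • x,
        ⟨⟨‖x‖⁻¹ • x, by simpa using hun⟩, ?_, rfl⟩, ?_⟩
      · rw [hS']; exact smul_mem_coneAt hx (inv_pos.2 hn)
      · simp [smul_smul, hn.ne']
  rw [solidAngle, measureReal_def, Measure.toSphere_apply' _ hmeas, himg, ENNReal.toReal_mul,
    measure_sdiff_null (by simp), measureReal_def]
  simp

/-- The number of tetrahedra at a vertex is at most `4π / Ω` if `Ω` is a lower bound for the solid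
angles. -/
theorem card_mul_le {M : Geometry.SimplicialComplex ℝ E3} {Ω : ℝ}
    (hΩ : ∀ t : Affine.Simplex ℝ E3 3, IsTetrahedronOf t M → ∀ i : Fin 4, Ω ≤ solidAngle t i)
    {v : E3} {S : Finset (Finset E3)} (hS : ∀ s ∈ S, s ∈ tetrahedra M ∧ v ∈ s) :
    S.card * Ω ≤ 4 * Real.pi := by
  have h1 := sum_measureReal_le (S := S) (A := fun s => coneAt s v ∩ Metric.ball 0 1)
    (B := Metric.ball 0 1)
    (fun s hs t ht hst => (aedisjoint_coneAt (hS s hs).1 (hS t ht).1 (hS s hs).2 (hS t ht).2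
      hst).mono Set.inter_subset_left Set.inter_subset_left)
    (fun s hs => ((measurableSet_coneAt (hS s hs).2).inter measurableSet_ball).nullMeasurableSet)
    (fun s _ => Set.inter_subset_right) measure_ball_lt_top.ne
  rw [volume_real_ball _ zero_le_one] at h1
  have h2 : ∑ s ∈ S, Ω / 3 ≤ ∑ s ∈ S, volume.real (coneAt s v ∩ Metric.ball 0 1) := by
    refine Finset.sum_le_sum fun s hs => ?_
    obtain ⟨t, ht⟩ := exists_simplex_of_isTet (IsTet.of_mem (hS s hs).1)
    obtain ⟨i, hi⟩ : v ∈ Set.range t.points := by rw [← ht]; exact (hS s hs).2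
    have := hΩ t ⟨s, (hS s hs).1, ht⟩ i
    rw [solidAngle_eq ht i, hi] at this
    linarith
  rw [Finset.sum_const, nsmul_eq_mul] at h2
  linarith

namespace MeshBalls

variable {M : Geometry.SimplicialComplex ℝ E3} {ρ : ℝ} {I O : Finset E3 → E3}
  {r R : Finset E3 → ℝ}

/-- The number of tetrahedra at a vertex is bounded in terms of the ratio of the radii. -/
theorem card_le_of_mem (h : MeshBalls M ρ I O r R) (hρ : 3 < ρ)
    {v : E3} {S : Finset (Finset E3)} (hS : ∀ s ∈ S, s ∈ tetrahedra M ∧ v ∈ s) :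
    (S.card : ℝ) ≤ 24 * ρ ^ 2 - 24 * ρ + 8 := by
  have hρ0 : 0 < ρ := by linarith
  have hρ1 : 1 / ρ < 1 := by rw [div_lt_one hρ0]; linarith
  -- Scaling the inscribed balls towards the vertex yields balls of radius 1 / (2ρ) touching both
  -- spheres of this shell. Using the shell instead of the whole ball makes the count quadratic in
  -- `ρ`, not cubic.
  set B : Set E3 := Metric.closedBall 0 1 \ Metric.ball 0 (1 - 1 / ρ) with hB
  have h1 := sum_measureReal_le (S := S) (A := fun s => coneAt s v ∩ B) (B := B)
    (fun s hs t ht hst => (aedisjoint_coneAt (hS s hs).1 (hS t ht).1 (hS s hs).2 (hS t ht).2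
      hst).mono Set.inter_subset_left Set.inter_subset_left)
    (fun s hs => ((measurableSet_coneAt (hS s hs).2).inter
      (measurableSet_closedBall.diff measurableSet_ball)).nullMeasurableSet)
    (fun s _ => Set.inter_subset_right)
    (ne_top_of_le_ne_top measure_closedBall_lt_top.ne (measure_mono Set.sdiff_subset))
  have hvolB : volume.real B = Real.pi * 4 / 3 * (1 - (1 - 1 / ρ) ^ 3) := by
    rw [hB, measureReal_sdiff (fun x hx => ?_) measurableSet_ball measure_closedBall_lt_top.ne,
      volume_real_closedBall _ zero_le_one, volume_real_ball _ (by linarith)]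
    · ring
    · have : 0 < 1 / ρ := by positivity
      simp only [Metric.mem_ball, Metric.mem_closedBall] at hx ⊢
      linarith
  have h2 : ∀ s ∈ S, (1 / (2 * ρ)) ^ 3 * (Real.pi * 4 / 3) ≤ volume.real (coneAt s v ∩ B) := by
    intro s hs
    obtain ⟨hsT, hvs⟩ := hS s hs
    have hb := h.balls s hsT
    have hr := hb.r_pos
    have hlt := h.lt s hsT
    have hIv : I s ≠ v := by
      rintro hI
      obtain ⟨u, hu, huv⟩ : ∃ u ∈ s, v ≠ u := by
        obtain ⟨u, hu, huv⟩ := Finset.exists_mem_ne (s := s) (by rw [hb.isTet.2]; norm_num) v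
        exact ⟨u, hu, huv.symm⟩
      have h3 := hb.one_le_gradBary_mul_dist hu hvs huv.symm
      have h4 := (hb.gradBary_mul_le u).1
      rw [hI, bary_of_ne hb.isTet hvs huv] at h4
      have h5 : ‖gradBary s u‖ ≤ 0 := by nlinarith
      have := dist_nonneg (x := u) (y := v)
      nlinarith
    have hx : 0 < ‖I s - v‖ := norm_pos_iff.2 (sub_ne_zero.2 hIv)
    have hxle : ‖I s - v‖ ≤ (2 * ρ - 1) * r s := by
      -- The inscribed ball lies in the circumscribed one.
      have h3 : dist (I s) (O s) + r s ≤ R s := by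
        rcases eq_or_ne (I s) (O s) with heq | heq
        · rw [heq, dist_self]; linarith [hb.three_mul_r_le]
        · have hn : 0 < ‖I s - O s‖ := norm_pos_iff.2 (sub_ne_zero.2 heq)
          have hmem : I s + (r s / ‖I s - O s‖) • (I s - O s) ∈ Metric.closedBall (O s) (R s) := by
            refine hb.convexHull_subset (hb.ball_subset ?_)
            simp [norm_smul, abs_of_pos hr, hn.ne']
          rw [Metric.mem_closedBall, dist_eq_norm, add_sub_right_comm] at hmem
          have : I s - O s + (r s / ‖I s - O s‖) • (I s - O s) =
              (1 + r s / ‖I s - O s‖) • (I s - O s) := by rw [add_smul, one_smul]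
          rw [this, norm_smul, Real.norm_of_nonneg (by positivity), add_mul, one_mul,
            div_mul_cancel₀ _ hn.ne'] at hmem
          rwa [dist_eq_norm]
      have h4 := dist_triangle_right (I s) v (O s)
      rw [hb.dist_eq v hvs, dist_eq_norm (I s) v] at h4
      linarith
    set a : ℝ := (1 - 1 / (2 * ρ)) / ‖I s - v‖ with ha
    have h2ρ : 1 / (2 * ρ) < 1 := by rw [div_lt_one (by linarith)]; linarith
    have ha0 : 0 < a := div_pos (by linarith) hx
    have har : 1 / (2 * ρ) ≤ a * r s := by
      rw [ha, div_mul_eq_mul_div, le_div_iff₀ hx]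
      have : (1 - 1 / (2 * ρ)) * r s = 1 / (2 * ρ) * ((2 * ρ - 1) * r s) := by
        field_simp
      rw [this]
      gcongr
    rw [← volume_real_closedBall (a • (I s - v)) (by positivity)]
    refine measureReal_mono (fun y hy => ⟨?_, ?_⟩)
      (ne_top_of_le_ne_top measure_closedBall_lt_top.ne
        (measure_mono (Set.inter_subset_right.trans Set.sdiff_subset)))
    · have hy' : a⁻¹ • y ∈ coneAt s v := by
        refine ⟨1, one_pos, hb.ball_subset ?_⟩
        rw [Metric.mem_closedBall, dist_eq_norm] at hy ⊢
        have : v + (1 : ℝ) • a⁻¹ • y - I s = a⁻¹ • (y - a • (I s - v)) := by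
          rw [smul_sub, smul_smul a⁻¹ a, inv_mul_cancel₀ ha0.ne']; module
        rw [this, norm_smul, norm_inv, Real.norm_of_nonneg ha0.le, inv_mul_le_iff₀ ha0]
        exact hy.trans har
      have := smul_mem_coneAt hy' ha0
      rwa [smul_smul, mul_inv_cancel₀ ha0.ne', one_smul] at this
    · have hc : ‖a • (I s - v)‖ = 1 - 1 / (2 * ρ) := by
        rw [norm_smul, Real.norm_of_nonneg ha0.le, ha, div_mul_cancel₀ _ hx.ne']
      rw [Metric.mem_closedBall, dist_eq_norm] at hy
      have h3 := norm_sub_norm_le y (a • (I s - v))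
      have h4 := norm_sub_norm_le (a • (I s - v)) y
      rw [norm_sub_rev] at h4
      have h5 : 1 / ρ = 2 * (1 / (2 * ρ)) := by field_simp
      refine ⟨?_, ?_⟩
      · rw [mem_closedBall_zero_iff]; linarith
      · rw [mem_ball_zero_iff]; linarith
  have h3 := (Finset.sum_le_sum h2).trans h1
  rw [Finset.sum_const, nsmul_eq_mul, hvolB] at h3
  have hpi := Real.pi_pos
  have h4 : (S.card : ℝ) * (1 / (2 * ρ)) ^ 3 ≤ 1 - (1 - 1 / ρ) ^ 3 := by
    have : Real.pi * 4 / 3 * ((S.card : ℝ) * (1 / (2 * ρ)) ^ 3) ≤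
      Real.pi * 4 / 3 * (1 - (1 - 1 / ρ) ^ 3) := by linarith
    exact le_of_mul_le_mul_left this (by positivity)
  have h5 : (1 / (2 * ρ)) ^ 3 * (24 * ρ ^ 2 - 24 * ρ + 8) = 1 - (1 - 1 / ρ) ^ 3 := by
    field_simp; ring
  rw [← h5, mul_comm] at h4
  exact le_of_mul_le_mul_left h4 (by positivity)

end MeshBalls

/-! ### Lower bound for the volume of a cone in terms of edge lengths. -/

/-- The six coordinate permutations of this set cover the unit cube. -/
theorem volume_real_ordered_le :
    1 / 6 ≤ volume.real {x : E3 | 0 ≤ x 2 ∧ x 2 ≤ x 1 ∧ x 1 ≤ x 0 ∧ x 0 ≤ 1} := by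
  set Δ : Set E3 := {x : E3 | 0 ≤ x 2 ∧ x 2 ≤ x 1 ∧ x 1 ≤ x 0 ∧ x 0 ≤ 1} with hΔ
  set Q : Set E3 := WithLp.ofLp ⁻¹' Set.Icc (0 : Fin 3 → ℝ) 1 with hQ
  have hQv : volume Q = 1 := by
    rw [hQ, (PiLp.volume_preserving_ofLp (Fin 3)).measure_preimage
      measurableSet_Icc.nullMeasurableSet, Real.volume_Icc_pi]
    simp
  have hΔQ : Δ ⊆ Q := by
    rintro x ⟨h1, h2, h3, h4⟩
    refine ⟨fun i => ?_, fun i => ?_⟩ <;> fin_cases i <;> simp <;> linarith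
  have hsub : Q ⊆ ⋃ σ : Equiv.Perm (Fin 3),
      (LinearIsometryEquiv.piLpCongrLeft 2 ℝ ℝ σ) ⁻¹' Δ := by
    rintro x ⟨hx0, hx1⟩
    have hsort := Tuple.monotone_sort (fun i => - x i)
    refine Set.mem_iUnion.2 ⟨(Tuple.sort fun i => - x i).symm, ?_, ?_, ?_, ?_⟩
    · simpa using hx0 _
    · simpa using hsort (show (1 : Fin 3) ≤ 2 by decide)
    · simpa using hsort (show (0 : Fin 3) ≤ 1 by decide)
    · simpa using hx1 _
  have h1 : volume Q ≤ ∑ σ : Equiv.Perm (Fin 3),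
      volume ((LinearIsometryEquiv.piLpCongrLeft 2 ℝ ℝ σ) ⁻¹' Δ) := by
    refine (measure_mono hsub).trans ?_
    exact measure_iUnion_fintype_le _ _
  have hmeas : MeasurableSet Δ := by
    have : IsClosed Δ := by
      simp only [hΔ, Set.ofPred_and]
      refine IsClosed.inter ?_ (IsClosed.inter ?_ (IsClosed.inter ?_ ?_)) <;>
        exact isClosed_le (by fun_prop) (by fun_prop)
    exact this.measurableSet
  have h2 : ∀ σ : Equiv.Perm (Fin 3),
      volume ((LinearIsometryEquiv.piLpCongrLeft 2 ℝ ℝ σ) ⁻¹' Δ) = volume Δ := fun σ =>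
    (LinearIsometryEquiv.measurePreserving _).measure_preimage hmeas.nullMeasurableSet
  rw [Finset.sum_congr rfl fun σ _ => h2 σ, hQv, Finset.sum_const, Finset.card_univ,
    Fintype.card_perm, Fintype.card_fin, nsmul_eq_mul] at h1
  have h3 := ENNReal.toReal_mono (by
    refine ENNReal.mul_ne_top (by simp) (ne_top_of_le_ne_top ?_ (measure_mono hΔQ))
    simp [hQv]) h1
  simp only [ENNReal.toReal_one, ENNReal.toReal_mul, ENNReal.toReal_natCast] at h3
  rw [measureReal_def]
  norm_num [Nat.factorial] at h3
  linarith

/-- The volume of a simplex is at least one sixth of a determinant. -/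
theorem abs_det_le_volume (f : Fin 3 → E3) {K : Set E3} (hK : Convex ℝ K) (hb : volume K ≠ ⊤)
    (h0 : 0 ∈ K) (hf : ∀ i, f i ∈ K) :
    |(EuclideanSpace.basisFun (Fin 3) ℝ).toBasis.det f| / 6 ≤ volume.real K := by
  set b := (EuclideanSpace.basisFun (Fin 3) ℝ).toBasis with hbdef
  set G : E3 →ₗ[ℝ] E3 := b.constr ℝ f with hG
  -- These columns send the vertices (0,0,0), (1,0,0), (1,1,0), (1,1,1) of the ordered simplex to 0,
  -- `f 0`, `f 1`, `f 2`, with the same determinant as `f`.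
  set F : E3 →ₗ[ℝ] E3 := b.constr ℝ ![f 0, f 1 - f 0, f 2 - f 1] with hF
  have hFb : F ∘ b = ![f 0, f 1 - f 0, f 2 - f 1] := by
    ext1 i; simp [hF]
  have hdet : LinearMap.det F = b.det f := by
    have h1 := b.det_comp F b
    rw [b.det_self, mul_one, hFb] at h1
    rw [← h1]
    simp only [Module.Basis.det_apply, Matrix.det_fin_three, Module.Basis.toMatrix_apply]
    simp
    ring
  set Δ : Set E3 := {x : E3 | 0 ≤ x 2 ∧ x 2 ≤ x 1 ∧ x 1 ≤ x 0 ∧ x 0 ≤ 1} with hΔ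
  have hsub : F '' Δ ⊆ K := by
    rintro _ ⟨x, ⟨h1, h2, h3, h4⟩, rfl⟩
    have hx : F x = (1 - x 0) • (0 : E3) + (x 0 - x 1) • f 0 + (x 1 - x 2) • f 1 + x 2 • f 2 := by
      rw [hF, Module.Basis.constr_apply_fintype, Fin.sum_univ_three]
      simp [hbdef, EuclideanSpace.basisFun_repr]
      module
    have := hK.sum_mem (t := Finset.univ) (w := ![1 - x 0, x 0 - x 1, x 1 - x 2, x 2])
      (z := ![0, f 0, f 1, f 2]) (fun i _ => by fin_cases i <;> simp <;> linarith)
      (by simp [Fin.sum_univ_four]) (fun i _ => by fin_cases i <;> simp [h0, hf])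
    rw [hx]
    simpa [Fin.sum_univ_four] using this
  have h1 : volume.real (F '' Δ) = |LinearMap.det F| * volume.real Δ := by
    rw [measureReal_def, Measure.addHaar_image_linearMap, ENNReal.toReal_mul,
      ENNReal.toReal_ofReal (abs_nonneg _), measureReal_def]
  have h2 := measureReal_mono hsub hb
  rw [h1, hdet] at h2
  have h3 := mul_le_mul_of_nonneg_left volume_real_ordered_le (abs_nonneg (b.det f))
  linarith

theorem convex_coneAt {s : Finset E3} {v : E3} (hv : v ∈ s) : Convex ℝ (coneAt s v) := by
  rintro x ⟨b, hb, hx⟩ y ⟨c, hc, hy⟩ α β hα hβ hαβ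
  have hm : 0 < min b c := lt_min hb hc
  refine ⟨min b c, hm, ?_⟩
  have := convex_convexHull ℝ (s : Set E3) (add_smul_mem_of_le hv hm (min_le_left _ _) hx)
    (add_smul_mem_of_le hv hm (min_le_right _ _) hy) hα hβ hαβ
  convert this using 1
  have h1 : v = (α + β) • v := by rw [hαβ, one_smul]
  nth_rw 1 [h1]
  module

/-- The cone at a vertex is large if two of the edges at this vertex are short. -/
theorem HasBalls.le_volume_coneAt {s : Finset E3} {I O : E3} {r R : ℝ} (h : HasBalls s I O r R)
    {v : E3} {u : Fin 3 → E3} (hs : ∀ x, x ∈ s ↔ x = v ∨ ∃ i, x = u i) (huv : ∀ i, u i ≠ v)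
    (hu : Function.Injective u) :
    2 * r ^ 2 / (3 * (dist (u 0) v * dist (u 1) v)) ≤
      volume.real (coneAt s v ∩ Metric.closedBall 0 1) := by
  classical
  have hr := h.r_pos
  have hv : v ∈ s := (hs v).2 (Or.inl rfl)
  have hus : ∀ i, u i ∈ s := fun i => (hs _).2 (Or.inr ⟨i, rfl⟩)
  have hd : ∀ i, 0 < dist (u i) v := fun i => dist_pos.2 (huv i)
  set e : Fin 3 → E3 := fun i => (dist (u i) v)⁻¹ • (u i - v) with he
  have hen : ∀ i, ‖e i‖ = 1 := fun i => by
    rw [he]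
    simp only [norm_smul, norm_inv, Real.norm_of_nonneg (hd i).le]
    rw [← dist_eq_norm, inv_mul_cancel₀ (hd i).ne']
  have hsum : ∀ x : E3, x = ∑ i, (inner ℝ (gradBary s (u i)) x) • (u i - v) := by
    intro x
    have hs' : s = insert v (Finset.univ.image u) := by
      ext y
      simp [hs, eq_comm]
    have h1 : x = ∑ y ∈ s, inner ℝ (gradBary s y) x • (y - v) := by
      have h2 : ∀ y ∈ s, inner ℝ (gradBary s y) x • (y - v) = (bary s y (x + v) • y - bary s y v • y)
          - (bary s y (x + v) - bary s y v) • v := by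
        intro y _
        rw [← sub_smul, bary_sub, add_sub_cancel_right, smul_sub]
      rw [Finset.sum_congr rfl h2, Finset.sum_sub_distrib, Finset.sum_sub_distrib,
        ← Finset.sum_smul, Finset.sum_sub_distrib, sum_bary_smul h.isTet, sum_bary_smul h.isTet,
        sum_bary h.isTet, sum_bary h.isTet]
      simp
    conv_lhs => rw [h1]
    conv_lhs => arg 1; rw [hs']
    rw [Finset.sum_insert (by simpa using huv), Finset.sum_image (by simpa using hu)]
    simp
  have hge : ∀ i j, inner ℝ (gradBary s (u i)) (e j) = if i = j then (dist (u j) v)⁻¹ else 0 := by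
    intro i j
    rw [he]
    simp only [inner_smul_right]
    rw [← bary_sub, bary_of_ne h.isTet hv (huv i).symm, sub_zero]
    split_ifs with hij
    · rw [hij, bary_self h.isTet (hus j), mul_one]
    · rw [bary_of_ne h.isTet (hus j) (fun h => hij (hu h).symm), mul_zero]
  have hscale : ∀ i, u i - v = dist (u i) v • e i := fun i => by
    rw [he]; simp only [smul_smul]; rw [mul_inv_cancel₀ (hd i).ne', one_smul]
  have hcone : ∀ i, e i ∈ coneAt s v := fun i =>
    smul_mem_coneAt ⟨1, one_pos, by simpa using subset_convexHull ℝ _ (hus i)⟩ (inv_pos.2 (hd i))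
  clear_value e
  have hgn : ∀ i (x : E3), 2 * r * |inner ℝ (gradBary s (u i)) x| ≤ ‖x‖ := by
    intro i x
    have h1 := abs_real_inner_le_norm (gradBary s (u i)) x
    have h2 := h.two_mul_gradBary_le (u i)
    nlinarith [norm_nonneg x]
  -- The cross product of `e 1` and `e 2`, so that `D` below is the determinant of `e`.
  set w : E3 := !₂[e 1 1 * e 2 2 - e 1 2 * e 2 1, e 1 2 * e 2 0 - e 1 0 * e 2 2,
    e 1 0 * e 2 1 - e 1 1 * e 2 0] with hw
  have hinner : ∀ x y : E3, inner ℝ x y = x 0 * y 0 + x 1 * y 1 + x 2 * y 2 := by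
    intro x y
    simp [PiLp.inner_apply, Fin.sum_univ_three, mul_comm]
  have hw1 : inner ℝ (e 1) w = 0 := by rw [hinner, hw]; simp; ring
  have hw2 : inner ℝ (e 2) w = 0 := by rw [hinner, hw]; simp; ring
  set D : ℝ := inner ℝ (e 0) w with hD
  have hdet : (EuclideanSpace.basisFun (Fin 3) ℝ).toBasis.det e = D := by
    simp only [Module.Basis.det_apply, Matrix.det_fin_three, Module.Basis.toMatrix_apply, hD,
      hinner, hw]
    simp
    ring
  have hnorm : ‖w‖ ^ 2 = 1 - inner ℝ (e 1) (e 2) ^ 2 := by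
    have h1 : inner ℝ (e 1) (e 1) = (1 : ℝ) := by rw [real_inner_self_eq_norm_sq, hen]; norm_num
    have h2 : inner ℝ (e 2) (e 2) = (1 : ℝ) := by rw [real_inner_self_eq_norm_sq, hen]; norm_num
    have h3 : inner ℝ w w = inner ℝ (e 1) (e 1) * inner ℝ (e 2) (e 2) - inner ℝ (e 1) (e 2) ^ 2 := by
      simp only [hinner, hw]
      simp
      ring
    rw [← real_inner_self_eq_norm_sq, h3, h1, h2, one_mul]
  -- `‖w‖` is the distance from `e 1` to the line of `e 2`. The coordinate of `u 1` changes by 1 /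
  -- dist (u 1) v over this distance.
  have hwlow : 2 * r * (dist (u 1) v)⁻¹ ≤ ‖w‖ := by
    have h1 := hgn 1 (e 1 - inner ℝ (e 1) (e 2) • e 2)
    rw [inner_sub_right, inner_smul_right, hge, hge, if_pos rfl, if_neg (by decide), mul_zero,
      sub_zero, abs_of_pos (inv_pos.2 (hd 1))] at h1
    have h2 : ‖e 1 - inner ℝ (e 1) (e 2) • e 2‖ ^ 2 = ‖w‖ ^ 2 := by
      rw [hnorm, @norm_sub_sq_real, inner_smul_right, norm_smul, hen, hen, mul_one, Real.norm_eq_abs,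
        sq_abs]
      ring
    rwa [(sq_eq_sq₀ (norm_nonneg _) (norm_nonneg _)).1 h2] at h1
  -- In the expansion of `w` along the three edges only the edge to `u 0` is not orthogonal to `w`;
  -- its coefficient is bounded by the gradient estimate.
  have hDlow : 2 * r * ‖w‖ ≤ dist (u 0) v * |D| := by
    have h1 : ‖w‖ ^ 2 = inner ℝ (gradBary s (u 0)) w * (dist (u 0) v * D) := by
      have h2 : ‖w‖ ^ 2 = inner ℝ (∑ i, (inner ℝ (gradBary s (u i)) w) • (u i - v)) w := by
        rw [← hsum w, real_inner_self_eq_norm_sq]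
      rw [h2, sum_inner, Fin.sum_univ_three]
      simp only [inner_smul_left, hscale, hw1, hw2, ← hD]
      simp
    have h2 := hgn 0 w
    have h3 : ‖w‖ ^ 2 ≤ |inner ℝ (gradBary s (u 0)) w| * (dist (u 0) v * |D|) := by
      rw [h1]
      refine (le_abs_self _).trans ?_
      rw [abs_mul, abs_mul, abs_of_pos (hd 0)]
    have hw0 : 0 < ‖w‖ := lt_of_lt_of_le (by have := hd 1; positivity) hwlow
    have h4 : 2 * r * ‖w‖ ^ 2 ≤ ‖w‖ * (dist (u 0) v * |D|) := by
      have : 0 ≤ dist (u 0) v * |D| := mul_nonneg (hd 0).le (abs_nonneg _)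
      nlinarith
    nlinarith
  have hmain := abs_det_le_volume e ((convex_coneAt hv).inter (convex_closedBall (0 : E3) 1))
    (ne_top_of_le_ne_top measure_closedBall_lt_top.ne (measure_mono Set.inter_subset_right))
    ⟨⟨1, one_pos, by simpa using subset_convexHull ℝ _ hv⟩, by simp⟩
    (fun i => ⟨hcone i, by rw [mem_closedBall_zero_iff, hen]⟩)
  rw [hdet] at hmain
  refine le_trans ?_ hmain
  have h0 := hd 0
  have h1 := hd 1
  rw [div_le_iff₀ (by positivity)]
  have h3 : 2 * r ≤ ‖w‖ * dist (u 1) v := by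
    have := mul_le_mul_of_nonneg_right hwlow h1.le
    rwa [mul_assoc, inv_mul_cancel₀ h1.ne', mul_one] at this
  have h4 : 2 * r * (2 * r) ≤ dist (u 0) v * |D| * dist (u 1) v := by
    calc 2 * r * (2 * r) ≤ 2 * r * (‖w‖ * dist (u 1) v) := by gcongr
      _ = (2 * r * ‖w‖) * dist (u 1) v := by ring
      _ ≤ _ := by gcongr
  linarith

/-! ### Growth of circumradii around a vertex. -/

open Classical in
/-- The graph of the tetrahedra at the vertex `v`, in which two tetrahedra are adjacent if they have
a common face. -/
def vertexGraph (M : Geometry.SimplicialComplex ℝ E3) (v : E3) :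
    SimpleGraph {s : Finset E3 // s ∈ tetrahedra M ∧ v ∈ s} where
  Adj s t := s ≠ t ∧ 3 ≤ (s.1 ∩ t.1).card
  symm := ⟨fun s t h => ⟨h.1.symm, by rw [Finset.inter_comm]; exact h.2⟩⟩
  loopless := ⟨fun _ h => h.1 rfl⟩

theorem vertexGraph_reachable {M : Geometry.SimplicialComplex ℝ E3} {v : E3}
    {s t : {s : Finset E3 // s ∈ tetrahedra M ∧ v ∈ s}} [DecidableEq E3]
    (h : 3 ≤ (s.1 ∩ t.1).card) : (vertexGraph M v).Reachable s t := by
  by_cases hst : s = t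
  · rw [hst]
  · exact SimpleGraph.Adj.reachable ⟨hst, by convert h⟩

theorem IsTet.exists_sorted {s : Finset E3} (h : IsTet s) {v : E3} (hv : v ∈ s) :
    ∃ u : Fin 3 → E3, (∀ x, x ∈ s ↔ x = v ∨ ∃ i, x = u i) ∧ (∀ i, u i ≠ v) ∧
      Function.Injective u ∧ dist (u 0) v ≤ dist (u 1) v ∧ dist (u 1) v ≤ dist (u 2) v := by
  classical
  have hc : (s.erase v).card = 3 := by rw [Finset.card_erase_of_mem hv, h.2]
  let e : Fin 3 ≃ (s.erase v : Finset E3) := ((s.erase v).equivFinOfCardEq hc).symm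
  let σ := Tuple.sort fun i => dist (e i : E3) v
  have hsort := Tuple.monotone_sort fun i => dist (e i : E3) v
  refine ⟨fun i => e (σ i), fun x => ⟨fun hx => ?_, ?_⟩, fun i => ?_, ?_, ?_, ?_⟩
  · by_cases hxv : x = v
    · exact Or.inl hxv
    · refine Or.inr ⟨σ.symm (e.symm ⟨x, Finset.mem_erase.2 ⟨hxv, hx⟩⟩), by simp⟩
  · rintro (rfl | ⟨i, rfl⟩)
    · exact hv
    · exact Finset.mem_of_mem_erase (e (σ i)).2
  · exact Finset.ne_of_mem_erase (e (σ i)).2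
  · exact Subtype.val_injective.comp (e.injective.comp σ.injective)
  · exact hsort (show (0 : Fin 3) ≤ 1 by decide)
  · exact hsort (show (1 : Fin 3) ≤ 2 by decide)

theorem IsTetrahedralMesh.finite_tetrahedra_at {M : Geometry.SimplicialComplex ℝ E3}
    (hM : IsTetrahedralMesh M) (v : E3) : Finite {s : Finset E3 // s ∈ tetrahedra M ∧ v ∈ s} :=
  (hM.finite_tetrahedra.subset fun _ hs => hs.1).to_subtype

namespace MeshBalls

variable {M : Geometry.SimplicialComplex ℝ E3} {ρ : ℝ} {I O : Finset E3 → E3}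
  {r R : Finset E3 → ℝ}

theorem R_le_of_adj (h : MeshBalls M ρ I O r R) {v : E3}
    {s t : {s : Finset E3 // s ∈ tetrahedra M ∧ v ∈ s}} (hst : (vertexGraph M v).Adj s t) :
    R s.1 ≤ (ρ - 1) * R t.1 := by
  classical
  obtain ⟨u, hu, huv⟩ := Finset.exists_mem_ne (show 1 < (s.1 ∩ t.1).card by
    have := hst.2
    convert (show 1 < 3 by norm_num).trans_le this) v
  rw [Finset.mem_inter] at hu
  exact h.R_le_of_edge s.2.1 t.2.1 hu.1 s.2.2 hu.2 t.2.2 huv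

/-- Two faces of the middle tetrahedron share two vertices, so `s` and `a` still have a common edge
at `v`: two steps cost one factor. -/
theorem R_le_of_adj_adj (h : MeshBalls M ρ I O r R) {v : E3}
    {s t a : {s : Finset E3 // s ∈ tetrahedra M ∧ v ∈ s}} (hst : (vertexGraph M v).Adj s t)
    (hta : (vertexGraph M v).Adj t a) : R s.1 ≤ (ρ - 1) * R a.1 := by
  classical
  have h1 : 3 ≤ (s.1 ∩ t.1).card := by convert hst.2
  have h2 : 3 ≤ (t.1 ∩ a.1).card := by convert hta.2
  have h3 := Finset.card_union_add_card_inter (s.1 ∩ t.1) (t.1 ∩ a.1)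
  have h4 : ((s.1 ∩ t.1) ∪ (t.1 ∩ a.1)).card ≤ t.1.card := Finset.card_le_card
    (Finset.union_subset Finset.inter_subset_right Finset.inter_subset_left)
  rw [t.2.1.2] at h4
  obtain ⟨u, hu, huv⟩ := Finset.exists_mem_ne
    (show 1 < ((s.1 ∩ t.1) ∩ (t.1 ∩ a.1)).card by omega) v
  simp only [Finset.mem_inter] at hu
  exact h.R_le_of_edge s.2.1 a.2.1 hu.1.1 s.2.2 hu.2.2 a.2.2 huv

theorem R_le_pow_mul_of_walk (h : MeshBalls M ρ I O r R) (hρ : 3 < ρ) {v : E3} :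
    ∀ {s t : {s : Finset E3 // s ∈ tetrahedra M ∧ v ∈ s}} (p : (vertexGraph M v).Walk s t),
      R s.1 ≤ (ρ - 1) ^ ((p.length + 1) / 2) * R t.1
  | _, _, .nil => by simp
  | _, _, .cons hst .nil => by simpa using h.R_le_of_adj hst
  | _, _, .cons hst (.cons hta p) => by
    have h1 := h.R_le_of_adj_adj hst hta
    have h2 := R_le_pow_mul_of_walk h hρ p
    have h3 : ((SimpleGraph.Walk.cons hst (.cons hta p)).length + 1) / 2 =
        (p.length + 1) / 2 + 1 := by
      simp only [SimpleGraph.Walk.length_cons]; omega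
    rw [h3, pow_succ']
    calc _ ≤ _ := h1
      _ ≤ (ρ - 1) * ((ρ - 1) ^ ((p.length + 1) / 2) * R _) :=
        mul_le_mul_of_nonneg_left h2 (by linarith)
      _ = _ := by ring

/-- A path through at most 2k + 1 tetrahedra has at most 2k steps, which are taken in pairs. -/
theorem R_le_pow_mul (h : MeshBalls M ρ I O r R) (hρ : 3 < ρ) {v : E3} {k : ℕ}
    (hk : ∀ S : Finset (Finset E3), (∀ s ∈ S, s ∈ tetrahedra M ∧ v ∈ s) → S.card ≤ 2 * k + 1)
    {s t : {s : Finset E3 // s ∈ tetrahedra M ∧ v ∈ s}} (hst : (vertexGraph M v).Reachable s t) :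
    R s.1 ≤ (ρ - 1) ^ k * R t.1 := by
  classical
  have := h.mesh.finite_tetrahedra_at v
  have := Fintype.ofFinite {s : Finset E3 // s ∈ tetrahedra M ∧ v ∈ s}
  obtain ⟨p, hp⟩ := hst.exists_isPath
  have h1 := hp.length_lt
  have h2 := hk ((Finset.univ : Finset {s // s ∈ tetrahedra M ∧ v ∈ s}).map
    (Function.Embedding.subtype _)) fun a ha => by
      obtain ⟨x, -, rfl⟩ := Finset.mem_map.1 ha
      exact x.2
  rw [Finset.card_map, Finset.card_univ] at h2
  refine (h.R_le_pow_mul_of_walk hρ p).trans ?_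
  have := (h.balls _ t.2.1).R_pos
  gcongr
  · linarith
  · omega

/-- The circumradii of tetrahedra that are connected by common faces at a vertex have a ratio
bounded in terms of `ρ`. -/
theorem R_le_exp_mul (h : MeshBalls M ρ I O r R) (hρ : 3 < ρ) {v : E3}
    {s t : {s : Finset E3 // s ∈ tetrahedra M ∧ v ∈ s}} (hst : (vertexGraph M v).Reachable s t) :
    R s.1 ≤ ρ * Real.exp (4 * Real.pi * ρ ^ 2 / Real.exp 1) * R t.1 := by
  classical
  have := h.mesh.finite_tetrahedra_at v
  have := Fintype.ofFinite {s : Finset E3 // s ∈ tetrahedra M ∧ v ∈ s}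
  have hρ0 : 0 < ρ := by linarith
  have hsorted := fun x : {s : Finset E3 // s ∈ tetrahedra M ∧ v ∈ s} =>
    (IsTet.of_mem x.2.1).exists_sorted x.2.2
  choose u hu huv huinj h01 h12 using hsorted
  have hmem : ∀ x i, u x i ∈ x.1 := fun x i => (hu x _).2 (Or.inr ⟨i, rfl⟩)
  have hpos : ∀ x i, 0 < dist (u x i) v := fun x i => dist_pos.2 (huv x i)
  -- Longest over middle edge at `v`. A large ratio forces a thick cone, by the shape bound, so the
  -- total volume bounds the sum of the squares.
  set γ : {s : Finset E3 // s ∈ tetrahedra M ∧ v ∈ s} → ℝ :=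
    fun x => dist (u x 2) v / dist (u x 1) v with hγ
  have hγ0 : ∀ x, 0 < γ x := fun x => div_pos (hpos x 2) (hpos x 1)
  have hvol : ∀ x : {s : Finset E3 // s ∈ tetrahedra M ∧ v ∈ s}, γ x ^ 2 / (6 * ρ ^ 2) ≤
      volume.real (coneAt x.1 v ∩ Metric.closedBall 0 1) := by
    intro x
    have hb := h.balls _ x.2.1
    refine le_trans ?_ (hb.le_volume_coneAt (hu x) (huv x) (huinj x))
    have h0 := hpos x 0
    have h1 := hpos x 1
    have h2 := hpos x 2
    have h3 : dist (u x 2) v ≤ 2 * (ρ * r x.1) :=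
      (hb.dist_le (hmem x 2) x.2.2).trans (by have := h.lt _ x.2.1; linarith)
    have hr := hb.r_pos
    calc γ x ^ 2 / (6 * ρ ^ 2) ≤ (2 * (ρ * r x.1) / dist (u x 1) v) ^ 2 / (6 * ρ ^ 2) := by
          have : γ x ≤ 2 * (ρ * r x.1) / dist (u x 1) v := by
            simp only [hγ]
            gcongr
          gcongr
      _ = 2 * r x.1 ^ 2 / (3 * (dist (u x 1) v * dist (u x 1) v)) := by field_simp; ring
      _ ≤ _ := by gcongr; exact h01 x
  have hsum : ∑ x, γ x ^ 2 ≤ 8 * Real.pi * ρ ^ 2 := by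
    have h1 := sum_measureReal_le (S := Finset.univ)
      (A := fun x : {s : Finset E3 // s ∈ tetrahedra M ∧ v ∈ s} =>
        coneAt x.1 v ∩ Metric.closedBall 0 1) (B := Metric.closedBall 0 1)
      (fun x _ y _ hxy => (aedisjoint_coneAt x.2.1 y.2.1 x.2.2 y.2.2
        (fun h => hxy (Subtype.ext h))).mono Set.inter_subset_left Set.inter_subset_left)
      (fun x _ => ((measurableSet_coneAt x.2.2).inter measurableSet_closedBall).nullMeasurableSet)
      (fun x _ => Set.inter_subset_right) measure_closedBall_lt_top.ne
    rw [volume_real_closedBall _ zero_le_one] at h1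
    have h2 := (Finset.sum_le_sum fun x _ => hvol x).trans h1
    rw [← Finset.sum_div, div_le_iff₀ (by positivity)] at h2
    linarith
  -- Adjacent tetrahedra share two edges at `v`. The longer of these is at least the middle edge of
  -- `x` and at most the longest edge of `y`.
  have hadj : ∀ x y, (vertexGraph M v).Adj x y → dist (u x 1) v ≤ dist (u y 2) v := by
    intro x y hxy
    have h3 : 3 ≤ (x.1 ∩ y.1).card := by convert hxy.2
    have htop : ∀ z ∈ y.1, dist z v ≤ dist (u y 2) v := by
      intro z hz
      rcases (hu y z).1 hz with rfl | ⟨i, rfl⟩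
      · rw [dist_self]; exact dist_nonneg
      · fin_cases i
        · exact (h01 y).trans (h12 y)
        · exact h12 y
        · exact le_rfl
    by_contra hlt
    push Not at hlt
    have hsub : x.1 ∩ y.1 ⊆ {v, u x 0} := by
      intro z hz
      rw [Finset.mem_inter] at hz
      have hz1 := htop z hz.2
      rcases (hu x z).1 hz.1 with rfl | ⟨i, rfl⟩
      · simp
      · fin_cases i
        · simp
        · exact absurd (hlt.trans_le' hz1) (lt_irrefl _)
        · exact absurd ((hlt.trans_le (h12 x)).trans_le' hz1) (lt_irrefl _)
    have := (Finset.card_le_card hsub).trans Finset.card_le_two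
    omega
  have hwalk : ∀ {x y} (p : (vertexGraph M v).Walk x y),
      dist (u x 1) v ≤ (p.support.tail.map γ).prod * dist (u y 1) v := by
    intro x y p
    induction p with
    | nil => simp
    | @cons x z y hxz p ih =>
      rw [SimpleGraph.Walk.support_cons, List.tail_cons, ← p.cons_tail_support, List.map_cons,
        List.prod_cons]
      calc dist (u x 1) v ≤ dist (u z 2) v := hadj _ _ hxz
        _ = γ z * dist (u z 1) v := by rw [hγ]; simp only; rw [div_mul_cancel₀ _ (hpos z 1).ne']
        _ ≤ γ z * ((p.support.tail.map γ).prod * dist (u y 1) v) :=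
          mul_le_mul_of_nonneg_left ih (hγ0 z).le
        _ = _ := by ring
  obtain ⟨p, hp⟩ := hst.exists_isPath
  have hnodup : p.support.tail.Nodup := hp.support_nodup.tail
  have hprod : (p.support.tail.map γ).prod ≤ Real.exp (4 * Real.pi * ρ ^ 2 / Real.exp 1) := by
    -- This is t ≤ exp (t - 1) at t = γ² / e. It turns the bound for the sum of squares into one for
    -- the product along a path, whatever its length.
    have h1 : ∀ x, γ x ≤ Real.exp (γ x ^ 2 / (2 * Real.exp 1)) := by
      intro x
      have h2 := Real.add_one_le_exp (γ x ^ 2 / Real.exp 1 - 1)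
      rw [sub_add_cancel, Real.exp_sub, div_le_div_iff_of_pos_right (Real.exp_pos 1)] at h2
      have h3 : Real.exp (γ x ^ 2 / Real.exp 1) = Real.exp (γ x ^ 2 / (2 * Real.exp 1)) ^ 2 := by
        rw [← Real.exp_nat_mul]; congr 1; push_cast; field_simp
      rw [h3] at h2
      exact (sq_le_sq₀ (hγ0 x).le (Real.exp_pos _).le).1 h2
    rw [← List.prod_toFinset γ hnodup]
    calc ∏ x ∈ p.support.tail.toFinset, γ x
        ≤ ∏ x ∈ p.support.tail.toFinset, Real.exp (γ x ^ 2 / (2 * Real.exp 1)) :=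
          Finset.prod_le_prod (fun x _ => (hγ0 x).le) fun x _ => h1 x
      _ = Real.exp (∑ x ∈ p.support.tail.toFinset, γ x ^ 2 / (2 * Real.exp 1)) :=
          (Real.exp_sum _ _).symm
      _ ≤ _ := by
        rw [Real.exp_le_exp, ← Finset.sum_div, div_le_div_iff₀ (by positivity) (by positivity)]
        have h4 : ∑ x ∈ p.support.tail.toFinset, γ x ^ 2 ≤ 8 * Real.pi * ρ ^ 2 :=
          (Finset.sum_le_sum_of_subset_of_nonneg (Finset.subset_univ _)
            fun x _ _ => sq_nonneg _).trans hsum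
        have := Real.exp_pos 1
        nlinarith
  have hbs := h.balls _ s.2.1
  have hbt := h.balls _ t.2.1
  have h1 := hbs.two_mul_r_le_dist (hmem s 1) s.2.2 (huv s 1)
  have h2 := hbt.dist_le (hmem t 1) t.2.2
  have h3 := h.lt _ s.2.1
  have h4 : dist (u s 1) v ≤ Real.exp (4 * Real.pi * ρ ^ 2 / Real.exp 1) * (2 * R t.1) :=
    (hwalk p).trans (mul_le_mul hprod h2 dist_nonneg (Real.exp_pos _).le)
  have h5 : ρ * (2 * r s.1) ≤ ρ * (Real.exp (4 * Real.pi * ρ ^ 2 / Real.exp 1) * (2 * R t.1)) :=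
    mul_le_mul_of_nonneg_left (h1.trans h4) hρ0.le
  linarith

end MeshBalls

/-- Since arcsin x ≈ x, the exponent `k` is at least about 4.78 ρ², while log ρ > 1.08 and 4π / e <
4.65. The room left absorbs the factor 3 and the rounding of `k`. -/
theorem exp_le_pow_of_arcsin {ρ : ℝ} (hρ : 3 < ρ) {k : ℕ}
    (hk : 2 * Real.pi / (2 * Real.arcsin (3 * Real.sqrt 3 / (8 * ρ ^ 2))) < k + 1) :
    3 * Real.exp (4 * Real.pi * ρ ^ 2 / Real.exp 1) ≤ ρ ^ k := by
  have hρ2 : 9 < ρ ^ 2 := by nlinarith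
  have hs3 : Real.sqrt 3 ≤ 1.7321 := by
    rw [Real.sqrt_le_left (by norm_num)]; norm_num
  have hs0 : 0 < Real.sqrt 3 := Real.sqrt_pos.2 (by norm_num)
  set x : ℝ := 3 * Real.sqrt 3 / (8 * ρ ^ 2) with hx
  have hx0 : 0 < x := by positivity
  have hx1 : x ≤ 0.65 / ρ ^ 2 := by
    rw [hx, div_le_div_iff₀ (by positivity) (by positivity)]
    nlinarith
  have hx2 : x ≤ 0.0725 := by
    refine hx1.trans ?_
    rw [div_le_iff₀ (by positivity)]
    linarith
  have harc : Real.arcsin x ≤ 1.01 * x := by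
    rw [Real.arcsin_le_iff_le_sin' ⟨by linarith [Real.pi_pos], by linarith [Real.pi_gt_three]⟩]
    have := Real.sin_gt_sub_cube (x := 1.01 * x) (by positivity)
    nlinarith [mul_pos hx0 hx0, sq_nonneg x]
  have harc0 : 0 < Real.arcsin x := Real.arcsin_pos.2 hx0
  have hpi := Real.pi_gt_d2
  have hpi' := Real.pi_lt_d2
  have hk1 : 4.78 * ρ ^ 2 ≤ k + 1 := by
    refine le_trans ?_ hk.le
    rw [mul_div_mul_left _ _ two_ne_zero, le_div_iff₀ harc0]
    calc 4.78 * ρ ^ 2 * Real.arcsin x ≤ 4.78 * ρ ^ 2 * (1.01 * (0.65 / ρ ^ 2)) := by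
          gcongr; linarith
      _ = 4.78 * (1.01 * 0.65) := by field_simp
      _ ≤ _ := by linarith
  have hlog : Real.exp 1.08 ≤ ρ := by
    have h1 : Real.exp 1.08 ^ 25 ≤ 3 ^ 25 := by
      rw [← Real.exp_nat_mul]
      norm_num
      have h2 : Real.exp 27 = Real.exp 1 ^ 27 := by rw [← Real.exp_nat_mul]; norm_num
      rw [h2]
      refine (pow_le_pow_left₀ (Real.exp_pos 1).le Real.exp_one_lt_d9.le 27).trans ?_
      norm_num
    have := (pow_le_pow_iff_left₀ (Real.exp_pos _).le (by norm_num) (by norm_num)).1 h1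
    linarith
  have h3 : (3 : ℝ) ≤ Real.exp 1.1 := by
    have h1 : (3 : ℝ) ^ 10 ≤ Real.exp 1.1 ^ 10 := by
      rw [← Real.exp_nat_mul]
      norm_num
      have h2 : Real.exp 11 = Real.exp 1 ^ 11 := by rw [← Real.exp_nat_mul]; norm_num
      rw [h2]
      refine le_trans ?_ (pow_le_pow_left₀ (by norm_num) Real.exp_one_gt_d9.le 11)
      norm_num
    exact (pow_le_pow_iff_left₀ (by norm_num) (Real.exp_pos _).le (by norm_num)).1 h1
  calc 3 * Real.exp (4 * Real.pi * ρ ^ 2 / Real.exp 1)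
      ≤ Real.exp 1.1 * Real.exp (4.65 * ρ ^ 2) := by
        gcongr
        rw [div_le_iff₀ (Real.exp_pos 1)]
        have := Real.exp_one_gt_d9
        nlinarith
    _ = Real.exp (1.1 + 4.65 * ρ ^ 2) := (Real.exp_add _ _).symm
    _ ≤ Real.exp (k * 1.08) := by
        rw [Real.exp_le_exp]; linarith
    _ = Real.exp 1.08 ^ k := Real.exp_nat_mul _ _
    _ ≤ ρ ^ k := by gcongr

namespace MeshBalls

variable {M : Geometry.SimplicialComplex ℝ E3} {ρ : ℝ} {I O : Finset E3 → E3}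
  {r R : Finset E3 → ℝ}

/-- The growth of the circumradii at a vertex is bounded in terms of the bound for `ε`. -/
theorem exists_growth (h : MeshBalls M ρ I O r R) (hρ : 3 < ρ) {Ω ε : ℝ}
    (hΩ : (0 < Ω ∧ ∀ t : Affine.Simplex ℝ E3 3, IsTetrahedronOf t M →
        ∀ i : Fin 4, Ω ≤ solidAngle t i) ∨
      Ω = 2 * Real.arcsin (3 * Real.sqrt 3 / (8 * ρ ^ 2))) (hε₀ : 0 ≤ ε)
    (hε : ε < 1 / (ρ ^ 2 + 1) * (1 / ρ) ^ (⌊2 * Real.pi / Ω⌋₊ + 3)) :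
    ∃ G : ℝ, 0 < G ∧ ε * ρ ^ 2 * G ≤ 1 / 30 ∧
      ∀ (v : E3) (s t : {s : Finset E3 // s ∈ tetrahedra M ∧ v ∈ s}),
        (vertexGraph M v).Reachable s t → R s.1 ≤ G * R t.1 := by
  have hρ0 : 0 < ρ := by linarith
  set k := ⌊2 * Real.pi / Ω⌋₊ with hkdef
  have hk := Nat.lt_floor_add_one (2 * Real.pi / Ω)
  rw [← hkdef] at hk
  have hε1 : ε * ((ρ ^ 2 + 1) * ρ ^ 3 * ρ ^ k) ≤ 1 := by
    have h1 : 1 / (ρ ^ 2 + 1) * (1 / ρ) ^ (k + 3) = 1 / ((ρ ^ 2 + 1) * ρ ^ 3 * ρ ^ k) := by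
      rw [one_div_pow, pow_add]; field_simp
    rw [h1, lt_div_iff₀ (by positivity)] at hε
    exact hε.le
  have hρ10 : 10 ≤ ρ ^ 2 + 1 := by nlinarith
  rcases hΩ with ⟨hΩ0, hΩ⟩ | hΩ
  · refine ⟨(ρ - 1) ^ k, pow_pos (by linarith) _, ?_, fun v s t hst =>
      h.R_le_pow_mul hρ (fun S hS => ?_) hst⟩
    · have h1 : 30 * (ρ ^ 2 * (ρ - 1) ^ k) ≤ (ρ ^ 2 + 1) * ρ ^ 3 * ρ ^ k := by
        have h2 : (ρ - 1) ^ k ≤ ρ ^ k := pow_le_pow_left₀ (by linarith) (by linarith) _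
        have h3 : 30 ≤ (ρ ^ 2 + 1) * ρ := by nlinarith
        have h4 : 0 ≤ (ρ - 1) ^ k := pow_nonneg (by linarith) _
        calc 30 * (ρ ^ 2 * (ρ - 1) ^ k) ≤ ((ρ ^ 2 + 1) * ρ) * (ρ ^ 2 * ρ ^ k) := by
              gcongr
          _ = _ := by ring
      have := mul_le_mul_of_nonneg_left h1 hε₀
      linarith
    · have h1 := card_mul_le hΩ hS
      rw [div_lt_iff₀ hΩ0] at hk
      have h2 : (S.card : ℝ) * Ω < (2 * k + 2 : ℕ) * Ω := by push_cast; linarith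
      have h3 : S.card < 2 * k + 2 := by exact_mod_cast lt_of_mul_lt_mul_right h2 hΩ0.le
      omega
  · rw [hΩ] at hk
    have h1 := exp_le_pow_of_arcsin hρ hk
    refine ⟨ρ * Real.exp (4 * Real.pi * ρ ^ 2 / Real.exp 1), by positivity, ?_,
      fun v s t hst => h.R_le_exp_mul hρ hst⟩
    have h2 : 30 * (ρ ^ 2 * (ρ * Real.exp (4 * Real.pi * ρ ^ 2 / Real.exp 1))) ≤
        (ρ ^ 2 + 1) * ρ ^ 3 * ρ ^ k := by
      calc 30 * (ρ ^ 2 * (ρ * Real.exp (4 * Real.pi * ρ ^ 2 / Real.exp 1)))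
          = 10 * ρ ^ 3 * (3 * Real.exp (4 * Real.pi * ρ ^ 2 / Real.exp 1)) := by ring
        _ ≤ (ρ ^ 2 + 1) * ρ ^ 3 * ρ ^ k := by gcongr
    have := mul_le_mul_of_nonneg_left h2 hε₀
    linarith

end MeshBalls

/-! ### Following a barycentric coordinate along the walk. -/

/-- Induction along an interval: a property that is inherited by larger numbers that are locally
related spreads from the left end to the right end. -/
theorem Icc_local_induction {a b : ℝ} (hab : a ≤ b) {C : ℝ → ℝ → Prop} {P : ℝ → Prop}
    (hsymm : ∀ x y, C x y → C y x)
    (hC : ∀ x ∈ Set.Icc a b, ∃ η > 0, ∀ y ∈ Set.Icc a b, |y - x| < η → C x y)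
    (hP : ∀ x ∈ Set.Icc a b, ∀ y ∈ Set.Icc a b, x ≤ y → C x y → P x → P y) (ha : P a) : P b := by
  set S : Set ℝ := {x | x ∈ Set.Icc a b ∧ P x} with hS
  have hbdd : BddAbove S := ⟨b, fun x hx => hx.1.2⟩
  have haS : a ∈ S := ⟨⟨le_rfl, hab⟩, ha⟩
  set c := sSup S with hc
  have hcab : c ∈ Set.Icc a b := ⟨le_csSup hbdd haS, csSup_le ⟨a, haS⟩ fun x hx => hx.1.2⟩
  obtain ⟨η, hη, hCη⟩ := hC c hcab
  obtain ⟨x, hx, hxc⟩ := exists_lt_of_lt_csSup ⟨a, haS⟩ (show c - η < c by linarith)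
  have hxc' : x ≤ c := le_csSup hbdd hx
  have hPc : P c := hP x hx.1 c hcab hxc' (hsymm _ _ (hCη x hx.1 (by
    rw [abs_lt]; constructor <;> linarith))) hx.2
  rcases hcab.2.eq_or_lt with hcb | hcb
  · rwa [← hcb]
  · exfalso
    have hy : min b (c + η / 2) ∈ Set.Icc a b :=
      ⟨le_min hab (by linarith [hcab.1]), min_le_left _ _⟩
    have hcy : c < min b (c + η / 2) := lt_min hcb (by linarith)
    have hPy : P (min b (c + η / 2)) := hP c hcab _ hy hcy.le (hCη _ hy (by
      rw [abs_lt]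
      constructor <;> linarith [min_le_right b (c + η / 2)])) hPc
    exact absurd (le_csSup hbdd ⟨hy, hPy⟩) (not_le.2 hcy)

theorem isClosed_convexHull (s : Finset E3) : IsClosed (convexHull ℝ (s : Set E3)) :=
  (s.finite_toSet.isCompact_convexHull (𝕜 := ℝ)).isClosed

/-- All points of the mesh near a given one have a common tetrahedron with it. -/
theorem IsTetrahedralMesh.exists_ball {M : Geometry.SimplicialComplex ℝ E3}
    (hM : IsTetrahedralMesh M) (z : E3) : ∃ η > 0, ∀ y ∈ M.space, dist y z < η →
      ∃ s ∈ tetrahedra M, z ∈ convexHull ℝ (s : Set E3) ∧ y ∈ convexHull ℝ (s : Set E3) := by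
  have hclosed : IsClosed (⋃ s ∈ {s ∈ tetrahedra M | z ∉ convexHull ℝ (s : Set E3)},
      convexHull ℝ (s : Set E3)) :=
    (hM.finite_tetrahedra.subset fun _ hs => hs.1).isClosed_biUnion
      fun s _ => isClosed_convexHull s
  obtain ⟨η, hη, hball⟩ := Metric.isOpen_iff.1 hclosed.isOpen_compl z (by
    simp only [Set.mem_compl_iff, Set.mem_iUnion, not_exists]
    exact fun s hs hz => hs.2 hz)
  refine ⟨η, hη, fun y hy hyz => ?_⟩
  obtain ⟨s, hs, hys⟩ := hM.mem_space_iff.1 hy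
  refine ⟨s, hs, ?_, hys⟩
  by_contra hz
  exact hball (Metric.mem_ball.2 hyz) (Set.mem_biUnion (show s ∈ {s ∈ tetrahedra M | _} from
    ⟨hs, hz⟩) hys)

namespace MeshBalls

variable {M : Geometry.SimplicialComplex ℝ E3} {ρ : ℝ} {I O : Finset E3 → E3}
  {r R : Finset E3 → ℝ}

/-- Along a path in the mesh that meets no edge, lower bounds for the barycentric coordinate of a
vertex are preserved as long as they exceed the loss that the inradii allow. -/
theorem exists_tetrahedron_of_path (h : MeshBalls M ρ I O r R) {γ : ℝ → E3} (hγ : Continuous γ)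
    {a c : ℝ} (hac : a ≤ c) (hspace : ∀ x ∈ Set.Icc a c, γ x ∈ M.space)
    (hgen : ∀ x ∈ Set.Icc a c, ∀ u ∈ M.vertices, ∀ w ∈ M.vertices, γ x ∉ affineSpan ℝ {u, w})
    {v : E3} (b : {s : Finset E3 // s ∈ tetrahedra M ∧ v ∈ s}) (B : ℝ → ℝ)
    (hB0 : ∀ x ∈ Set.Icc a c, 0 < B x)
    (hB : ∀ x y, a ≤ x → x ≤ y → y ≤ c → ∀ t : {s : Finset E3 // s ∈ tetrahedra M ∧ v ∈ s},
      (vertexGraph M v).Reachable b t → γ x ∈ convexHull ℝ (t.1 : Set E3) →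
        dist (γ x) (γ y) / (2 * r t.1) ≤ B x - B y)
    (ha : ∃ s : {s : Finset E3 // s ∈ tetrahedra M ∧ v ∈ s}, (vertexGraph M v).Reachable b s ∧
      γ a ∈ convexHull ℝ (s.1 : Set E3) ∧ B a ≤ bary s.1 v (γ a)) :
    ∃ s : {s : Finset E3 // s ∈ tetrahedra M ∧ v ∈ s}, (vertexGraph M v).Reachable b s ∧
      γ c ∈ convexHull ℝ (s.1 : Set E3) ∧ B c ≤ bary s.1 v (γ c) := by
  classical
  refine Icc_local_induction hac
    (C := fun x y => ∃ s ∈ tetrahedra M, γ x ∈ convexHull ℝ (s : Set E3) ∧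
      γ y ∈ convexHull ℝ (s : Set E3))
    (P := fun x => ∃ s : {s : Finset E3 // s ∈ tetrahedra M ∧ v ∈ s},
      (vertexGraph M v).Reachable b s ∧ γ x ∈ convexHull ℝ (s.1 : Set E3) ∧
        B x ≤ bary s.1 v (γ x))
    (fun x y ⟨s, hs, hx, hy⟩ => ⟨s, hs, hy, hx⟩) (fun x hx => ?_) (fun x hx y hy hxy => ?_) ha
  · obtain ⟨η, hη, hη'⟩ := h.mesh.exists_ball (γ x)
    obtain ⟨θ, hθ, hθ'⟩ := Metric.continuous_iff.1 hγ x η hη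
    exact ⟨θ, hθ, fun y hy hyx => hη' _ (hspace y hy) (hθ' y (by rwa [Real.dist_eq]))⟩
  · rintro ⟨t, ht, hxt, hyt⟩ ⟨s, hbs, hxs, hBs⟩
    -- As the lower bound `B` is positive, the coordinate of `v` does not vanish at `γ x`, so every
    -- tetrahedron containing this point has `v` as a vertex.
    have h1 := bary_eq_bary s.2.1 ht hxs hxt v
    have hvt : v ∈ t := mem_of_bary_ne_zero (z := γ x) (by rw [← h1]; linarith [hB0 x hx])
    have h2 := three_le_card_inter s.2.1 ht hxs hxt (hgen x hx)
    have hbt : (vertexGraph M v).Reachable b ⟨t, ht, hvt⟩ :=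
      hbs.trans (vertexGraph_reachable (by convert h2))
    refine ⟨⟨t, ht, hvt⟩, hbt, hyt, ?_⟩
    have h3 := hB x y hx.1 hxy hy.2 ⟨t, ht, hvt⟩ hbt hxt
    have h4 := (h.balls t ht).bary_sub_le v (γ x) (γ y)
    simp only at h3 ⊢
    linarith

/-- A walk towards `q` from a point in general position near a vertex that is almost a nearest one
ends in a tetrahedron at the vertex from which it comes. -/
theorem exists_vertex_of_generic (h : MeshBalls M ρ I O r R) (hρ : 3 < ρ) {ε G : ℝ}
    (hG0 : 0 < G) (hG : ε * ρ ^ 2 * G ≤ 1 / 30)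
    (hR : ∀ (v : E3) (s t : {s : Finset E3 // s ∈ tetrahedra M ∧ v ∈ s}),
      (vertexGraph M v).Reachable s t → R s.1 ≤ G * R t.1)
    {q z : E3} {d d₀ A Y τ : ℝ} (hd₀ : 0 < d₀) (hdd : d₀ ≤ d) (hdε : d ≤ (1 + ε) * d₀)
    (hY : Y = 2 * d₀ / (64 * ρ ^ 2 + 1)) (hA : A = 2 * d₀ - Y) (hτ : τ = (d₀ - Y) / d)
    (hq : ∀ v ∈ M.vertices, d₀ ≤ dist v q) (hz : dist z q ≤ d)
    (hseg : ∀ x ∈ Set.Icc (0 : ℝ) 1, AffineMap.lineMap q z x ∈ M.space)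
    (hgen : ∀ u ∈ M.vertices, ∀ w ∈ M.vertices, z ∉ affineSpan ℝ {q, u, w}) :
    ∃ b ∈ tetrahedra M, ∃ t ∈ tetrahedra M, ∃ v ∈ b,
      AffineMap.lineMap q z τ ∈ convexHull ℝ (b : Set E3) ∧ z ∈ convexHull ℝ (t : Set E3) ∧
        1 / 20 ≤ bary t v z := by
  have hρ0 : 0 < ρ := by linarith
  have hρ2 : 9 ≤ ρ ^ 2 := by nlinarith
  have hd0 : 0 < d := by linarith
  have hY0 : 0 < Y := by rw [hY]; positivity
  have hYA : A = 64 * ρ ^ 2 * Y := by rw [hA, hY]; field_simp; ring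
  have hA0 : 0 < A := by rw [hYA]; positivity
  have hYd : Y < d₀ := by nlinarith
  have hτ0 : 0 < τ := by rw [hτ]; exact div_pos (by linarith) hd0
  have hτd : τ * d = d₀ - Y := by rw [hτ]; field_simp
  set τ₀ := d₀ / d with hτ₀
  have hτ₀d : τ₀ * d = d₀ := by rw [hτ₀]; field_simp
  have hττ₀ : τ ≤ τ₀ := by
    rw [hτ, hτ₀]; gcongr; linarith
  have hτ₀1 : τ₀ ≤ 1 := by rw [hτ₀, div_le_one hd0]; exact hdd
  set γ : ℝ → E3 := fun x => AffineMap.lineMap q z x with hγ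
  have hγc : Continuous γ := AffineMap.lineMap_continuous
  have hγgen : ∀ x, 0 < x → ∀ u ∈ M.vertices, ∀ w ∈ M.vertices, γ x ∉ affineSpan ℝ {u, w} := by
    intro x hx u hu w hw hmem
    refine hgen u hu w hw ?_
    have h1 : γ x ∈ affineSpan ℝ ({q, u, w} : Set E3) :=
      affineSpan_mono ℝ (Set.subset_insert _ _) hmem
    have h2 : q ∈ affineSpan ℝ ({q, u, w} : Set E3) :=
      subset_affineSpan ℝ _ (Set.mem_insert _ _)
    have h3 := AffineMap.lineMap_mem x⁻¹ h2 h1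
    convert h3 using 1
    simp only [hγ, AffineMap.lineMap_apply, vsub_eq_sub, vadd_eq_add, add_sub_cancel_right]
    rw [smul_smul, inv_mul_cancel₀ hx.ne', one_smul, sub_add_cancel]
  have hγdist : ∀ x, 0 ≤ x → dist (γ x) q ≤ x * d := by
    intro x hx
    simp only [hγ]
    rw [dist_lineMap_left, Real.norm_of_nonneg hx, dist_comm]
    gcongr
  have hγdist' : ∀ x y, x ≤ y → dist (γ x) (γ y) ≤ y * d - x * d := by
    intro x y hxy
    simp only [hγ]
    rw [dist_lineMap_lineMap, Real.dist_eq, abs_of_nonpos (by linarith), dist_comm q z]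
    nlinarith
  -- Factor d₀² - (xd)² and use d₀ + xd ≥ 2d₀ - Y = A, which makes the bound linear in the depth.
  have hRγ : ∀ x, τ ≤ x → x ≤ τ₀ → ∀ s ∈ tetrahedra M, γ x ∈ convexHull ℝ (s : Set E3) →
      A * (d₀ - x * d) ≤ R s ^ 2 := by
    intro x hx hx' s hs hxs
    have h1 := (h.balls s hs).sq_sub_sq_le hd₀.le
      (fun v hv => hq v (mem_vertices_of_mem hs hv)) hxs
    have h2 : dist (γ x) q ^ 2 ≤ (x * d) ^ 2 :=
      pow_le_pow_left₀ dist_nonneg (hγdist x (by linarith)) 2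
    have h3 : x * d ≤ d₀ := by rw [← hτ₀d]; gcongr
    have h4 : d₀ - Y ≤ x * d := by rw [← hτd]; gcongr
    rw [hA]
    nlinarith
  have hr : ∀ s ∈ tetrahedra M, R s ≤ ρ * r s := fun s hs => (h.lt s hs).le
  have hτ1 : τ ≤ 1 := hττ₀.trans hτ₀1
  obtain ⟨b, hb, hτb⟩ := h.mesh.mem_space_iff.1 (hseg τ ⟨hτ0.le, hτ1⟩)
  obtain ⟨v, hvb, hv⟩ : ∃ v ∈ b, 1 / 4 ≤ bary b v (γ τ) := by
    by_contra hlt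
    push Not at hlt
    have h1 := sum_bary (IsTet.of_mem hb) (γ τ)
    have hne : b.Nonempty := Finset.card_pos.1 (by rw [hb.2]; norm_num)
    have h2 := Finset.sum_lt_sum_of_nonempty hne hlt
    rw [h1, Finset.sum_const, hb.2] at h2
    norm_num at h2
  have hsqrtA : Real.sqrt (A * Y) = A / (8 * ρ) := by
    rw [Real.sqrt_eq_iff_mul_self_eq (by positivity) (by positivity), hYA]
    field_simp; norm_num
  have hRb : A / (8 * ρ) ≤ R b := by
    rw [← hsqrtA]
    refine Real.sqrt_le_iff.2 ⟨(h.balls b hb).R_pos.le, ?_⟩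
    have := hRγ τ le_rfl hττ₀ b hb hτb
    rwa [hτd, sub_sub_cancel] at this
  -- At depth s the inradius is at least √(As) / ρ, so the loss rate is at most ρ / (2√(As)), with
  -- integral ρ√(As) / A. The choice of `Y` gives A = 64ρ²Y, hence the total loss 1/8.
  have phase1 := h.exists_tetrahedron_of_path hγc hττ₀
    (fun x hx => hseg x ⟨hτ0.le.trans hx.1, hx.2.trans hτ₀1⟩)
    (fun x hx => hγgen x (hτ0.trans_le hx.1)) ⟨b, hb, hvb⟩
    (fun x => 1 / 8 + ρ / A * Real.sqrt (A * (d₀ - x * d)))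
    (fun x hx => by positivity)
    (fun x y hx hxy hy t hbt hxt => by
      have hrt := (h.balls _ t.2.1).r_pos
      rw [div_le_iff₀ (by positivity)]
      refine (hγdist' x y hxy).trans ?_
      have h1 : y * d ≤ d₀ := by rw [← hτ₀d]; gcongr
      have h2 : x * d ≤ y * d := by gcongr
      set α := Real.sqrt (A * (d₀ - x * d)) with hα
      set β := Real.sqrt (A * (d₀ - y * d)) with hβ
      have hα2 : α ^ 2 = A * (d₀ - x * d) :=
        Real.sq_sqrt (mul_nonneg hA0.le (by linarith))
      have hβ2 : β ^ 2 = A * (d₀ - y * d) :=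
        Real.sq_sqrt (mul_nonneg hA0.le (by linarith))
      have hβα : β ≤ α := Real.sqrt_le_sqrt (by gcongr)
      have hα3 : α ≤ ρ * r t.1 := (Real.sqrt_le_iff.2
        ⟨(h.balls _ t.2.1).R_pos.le, hRγ x hx (hxy.trans hy) _ t.2.1 hxt⟩).trans (hr _ t.2.1)
      have h3 : A * (y * d - x * d) = (α - β) * (α + β) := by linear_combination hβ2 - hα2
      have h4 : A * (y * d - x * d) ≤ (α - β) * (2 * (ρ * r t.1)) := by
        rw [h3]
        exact mul_le_mul_of_nonneg_left (by linarith) (by linarith)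
      calc y * d - x * d = A * (y * d - x * d) / A := by field_simp
        _ ≤ (α - β) * (2 * (ρ * r t.1)) / A := by gcongr
        _ = _ := by ring)
    ⟨⟨b, hb, hvb⟩, SimpleGraph.Reachable.refl _, hτb, by
      rw [hτd, sub_sub_cancel, hsqrtA]
      refine le_trans (le_of_eq ?_) hv
      field_simp; norm_num⟩
  have hεd : d - d₀ ≤ ε * d₀ := by linarith
  -- Comparison with `b` gives r ≥ A / (8ρ²G), hence this bound for the loss beyond radius d₀. The
  -- fraction 577/1152 is the bound for d₀ / A at ρ² = 9. In the end 1/8 - 3/40 = 1/20 remains.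
  have hK : ε * d₀ * (4 * ρ ^ 2 * G / A) ≤ 3 / 40 := by
    have h1 : d₀ ≤ 577 / 1152 * A := by
      have : A * (64 * ρ ^ 2 + 1) = 2 * d₀ * (64 * ρ ^ 2) := by
        rw [hA, hY]; field_simp; ring
      nlinarith
    calc ε * d₀ * (4 * ρ ^ 2 * G / A) = 4 * (ε * ρ ^ 2 * G) * (d₀ / A) := by ring
      _ ≤ 4 * (1 / 30) * (577 / 1152) := by
        have h2 : d₀ / A ≤ 577 / 1152 := by rw [div_le_iff₀ hA0]; exact h1
        gcongr
      _ ≤ _ := by norm_num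
  have hK' : ∀ x, x ≤ 1 → (x * d - d₀) * (4 * ρ ^ 2 * G / A) ≤ 3 / 40 := fun x hx => by
    refine le_trans ?_ hK
    have : x * d ≤ 1 * d := by gcongr
    gcongr
    linarith
  obtain ⟨t, -, hzt, hvt⟩ := h.exists_tetrahedron_of_path hγc hτ₀1
    (fun x hx => hseg x ⟨(hτ0.le.trans hττ₀).trans hx.1, hx.2⟩)
    (fun x hx => hγgen x ((hτ0.trans_le hττ₀).trans_le hx.1)) ⟨b, hb, hvb⟩
    (fun x => 1 / 8 - (x * d - d₀) * (4 * ρ ^ 2 * G / A))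
    (fun x hx => by linarith [hK' x hx.2])
    (fun x y hx hxy hy t hbt hxt => by
      have hrt := (h.balls _ t.2.1).r_pos
      rw [div_le_iff₀ (by positivity)]
      refine (hγdist' x y hxy).trans ?_
      have h2 : x * d ≤ y * d := by gcongr
      have h3 : A / (8 * ρ) ≤ G * (ρ * r t.1) :=
        hRb.trans ((hR v _ _ hbt).trans (by gcongr; exact hr _ t.2.1))
      have h4 : 1 ≤ 4 * ρ ^ 2 * G / A * (2 * r t.1) := by
        rw [div_le_iff₀ (by positivity)] at h3
        rw [div_mul_eq_mul_div, le_div_iff₀ hA0]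
        linarith
      have h5 := mul_le_mul_of_nonneg_left h4 (sub_nonneg.2 h2)
      linarith)
    (by
      obtain ⟨s, h1, h2, h3⟩ := phase1
      refine ⟨s, h1, h2, ?_⟩
      simp only [hτ₀d, sub_self, mul_zero, Real.sqrt_zero, zero_mul] at h3 ⊢
      linarith)
  have hγ1 : γ 1 = z := by simp [hγ]
  rw [hγ1] at hzt hvt
  refine ⟨b, hb, t.1, t.2.1, v, hvb, hτb, hzt, le_trans ?_ hvt⟩
  linarith [hK' 1 le_rfl]

end MeshBalls

/-! ### General position and the initial tetrahedron. -/

theorem volume_affineSpan_triple (x y z : E3) :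
    volume (affineSpan ℝ ({x, y, z} : Set E3) : Set E3) = 0 := by
  refine Measure.addHaar_affineSubspace _ _ fun htop => ?_
  have h1 : Module.rank ℝ (vectorSpan ℝ ({x, y, z} : Set E3)) ≤ 2 := coplanar_triple ℝ x y z
  rw [← direction_affineSpan, htop, AffineSubspace.direction_top, rank_top,
    ← Module.finrank_eq_rank, finrank_euclideanSpace, Fintype.card_fin] at h1
  norm_cast at h1

/-- Near every point of the mesh other than `q` there are points of the mesh in general position
that are not further from `q`. -/
theorem MeshBalls.exists_generic {M : Geometry.SimplicialComplex ℝ E3} {ρ : ℝ}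
    {I O : Finset E3 → E3} {r R : Finset E3 → ℝ} (h : MeshBalls M ρ I O r R) {q a : E3}
    (ha : a ∈ M.space) (haq : a ≠ q)
    (hwalk : StarConvex ℝ q (M.space ∩ Metric.closedBall q (dist a q))) {η : ℝ} (hη : 0 < η) :
    ∃ z ∈ M.space, dist z q ≤ dist a q ∧ dist z a < η ∧
      ∀ u ∈ M.vertices, ∀ w ∈ M.vertices, z ∉ affineSpan ℝ {q, u, w} := by
  have hd : 0 < dist a q := dist_pos.2 haq
  obtain ⟨x, hx, hxq, hxa⟩ : ∃ x ∈ M.space, dist x q < dist a q ∧ dist x a < η := by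
    -- A small step towards `q` makes the distance to `q` strictly smaller, so that an open set of
    -- candidates becomes available.
    set θ := min (1 / 2) (η / (2 * dist a q)) with hθ
    have hθ0 : 0 < θ := lt_min (by norm_num) (by positivity)
    have hθ1 : θ ≤ 1 / 2 := min_le_left _ _
    have hθ2 : θ * dist a q < η := by
      have : θ ≤ η / (2 * dist a q) := min_le_right _ _
      rw [le_div_iff₀ (by positivity)] at this
      linarith
    refine ⟨AffineMap.lineMap a q θ, ?_, ?_, ?_⟩
    · have h1 := hwalk ⟨ha, Metric.mem_closedBall.2 le_rfl⟩ hθ0.le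
        (show 0 ≤ 1 - θ by linarith) (by ring)
      rw [AffineMap.lineMap_apply_module, add_comm]
      exact h1.1
    · rw [dist_lineMap_right, Real.norm_of_nonneg (by linarith)]
      nlinarith
    · rw [dist_lineMap_left, Real.norm_of_nonneg hθ0.le]
      exact hθ2
  obtain ⟨s, hs, hxs⟩ := h.mesh.mem_space_iff.1 hx
  set U := interior (convexHull ℝ (s : Set E3)) ∩ (Metric.ball q (dist a q) ∩ Metric.ball a η)
    with hU
  have hUo : IsOpen U := isOpen_interior.inter (Metric.isOpen_ball.inter Metric.isOpen_ball)
  have hint : (interior (convexHull ℝ (s : Set E3))).Nonempty := by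
    refine ⟨I s, interior_mono (h.balls s hs).ball_subset ?_⟩
    exact interior_mono Metric.ball_subset_closedBall (by
      rw [Metric.isOpen_ball.interior_eq]
      exact Metric.mem_ball_self (h.balls s hs).r_pos)
  have hcl : x ∈ closure (interior (convexHull ℝ (s : Set E3))) := by
    rw [(convex_convexHull ℝ (s : Set E3)).closure_interior_eq_closure_of_nonempty_interior hint]
    exact subset_closure hxs
  have hUne : U.Nonempty := by
    rw [hU, Set.inter_comm]
    exact mem_closure_iff.1 hcl _ (Metric.isOpen_ball.inter Metric.isOpen_ball) ⟨hxq, hxa⟩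
  have hnull : volume (⋃ u ∈ M.vertices, ⋃ w ∈ M.vertices,
      (affineSpan ℝ ({q, u, w} : Set E3) : Set E3)) = 0 := by
    have hc := h.mesh.finite_vertices.countable
    rw [measure_biUnion_null_iff hc]
    intro u _
    rw [measure_biUnion_null_iff hc]
    exact fun w _ => volume_affineSpan_triple _ _ _
  obtain ⟨z, hzU, hz⟩ : ∃ z ∈ U, z ∉ ⋃ u ∈ M.vertices, ⋃ w ∈ M.vertices,
      (affineSpan ℝ ({q, u, w} : Set E3) : Set E3) := by
    by_contra hsub
    push Not at hsub
    exact (hUo.measure_pos volume hUne).ne' (measure_mono_null hsub hnull)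
  refine ⟨z, h.mesh.mem_space_iff.2 ⟨s, hs, interior_subset hzU.1⟩, hzU.2.1.le, hzU.2.2,
    fun u hu w hw hzm => hz ?_⟩
  exact Set.mem_biUnion hu (Set.mem_biUnion hw hzm)

/-- A vertex lies in a tetrahedron only if it is one of its vertices. -/
theorem mem_of_mem_vertices {M : Geometry.SimplicialComplex ℝ E3} {s : Finset E3} {v : E3}
    (hs : s ∈ tetrahedra M) (hv : v ∈ M.vertices) (hvs : v ∈ convexHull ℝ (s : Set E3)) :
    v ∈ s := by
  have h1 : ({v} : Finset E3) ∈ M.faces := hv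
  have h2 := M.inter_subset_convexHull hs.1 h1 ⟨hvs, by simp⟩
  have h3 : ((s : Set E3) ∩ (({v} : Finset E3) : Set E3)).Nonempty :=
    convexHull_nonempty_iff.1 ⟨v, h2⟩
  obtain ⟨w, hw, hwv⟩ := h3
  simp only [Finset.coe_singleton, Set.mem_singleton_iff] at hwv
  rwa [hwv] at hw

namespace MeshBalls

variable {M : Geometry.SimplicialComplex ℝ E3} {ρ : ℝ} {I O : Finset E3 → E3}
  {r R : Finset E3 → ℝ}

/-- The walk from an approximate nearest neighbour `a` of `q` stays in one tetrahedron at `a` until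
it is closer to `q` than all vertices. -/
theorem exists_initial_tetrahedron (h : MeshBalls M ρ I O r R) (hρ : 3 < ρ) {ε G : ℝ}
    (hG0 : 0 < G) (hG : ε * ρ ^ 2 * G ≤ 1 / 30)
    (hR : ∀ (v : E3) (s t : {s : Finset E3 // s ∈ tetrahedra M ∧ v ∈ s}),
      (vertexGraph M v).Reachable s t → R s.1 ≤ G * R t.1)
    {q a : E3} {d₀ A Y τ : ℝ} (hd₀ : 0 < d₀) (hdd : d₀ ≤ dist a q)
    (hdε : dist a q ≤ (1 + ε) * d₀)
    (hY : Y = 2 * d₀ / (64 * ρ ^ 2 + 1)) (hA : A = 2 * d₀ - Y) (hτ : τ = (d₀ - Y) / dist a q)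
    (hq : ∀ v ∈ M.vertices, d₀ ≤ dist v q) (ha : a ∈ M.vertices)
    (hwalk : StarConvex ℝ q (M.space ∩ Metric.closedBall q (dist a q))) :
    ∃ b ∈ tetrahedra M, a ∈ b ∧ AffineMap.lineMap q a τ ∈ convexHull ℝ (b : Set E3) := by
  have haq : a ≠ q := dist_pos.1 (hd₀.trans_le hdd)
  have hfaces : ({a} : Finset E3) ∈ M.faces := ha
  obtain ⟨s, hs, has⟩ := h.mesh.exists_tetrahedron_superset hfaces
  have has' : a ∈ s := has (Finset.mem_singleton_self a)
  have hasp : a ∈ M.space := h.mesh.mem_space_iff.2 ⟨s, hs, subset_convexHull ℝ _ has'⟩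
  -- The conclusion for generic points, as a finite union of closed conditions; it therefore
  -- persists in the limit `a`.
  set F : Set E3 := ⋃ b ∈ tetrahedra M, ⋃ t ∈ tetrahedra M, ⋃ v ∈ (b : Set E3),
    {z | AffineMap.lineMap q z τ ∈ convexHull ℝ (b : Set E3)} ∩
      (convexHull ℝ (t : Set E3) ∩ {z | 1 / 20 ≤ bary t v z}) with hF
  have hFc : IsClosed F := by
    refine h.mesh.finite_tetrahedra.isClosed_biUnion fun b _ =>
      h.mesh.finite_tetrahedra.isClosed_biUnion fun t _ =>
        b.finite_toSet.isClosed_biUnion fun v _ => IsClosed.inter ?_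
          ((isClosed_convexHull t).inter (isClosed_le continuous_const (continuous_bary t v)))
    refine (isClosed_convexHull b).preimage ?_
    simp only [AffineMap.lineMap_apply_module]
    fun_prop
  have haF : a ∈ F := by
    rw [← hFc.closure_eq, Metric.mem_closure_iff]
    intro η hη
    obtain ⟨z, hz, hzq, hza, hgen⟩ := h.exists_generic hasp haq hwalk hη
    obtain ⟨b, hb, t, ht, v, hv, h1, h2, h3⟩ := h.exists_vertex_of_generic hρ hG0 hG hR hd₀ hdd hdε
      hY hA hτ hq hzq (fun x hx => by
        have := hwalk ⟨hz, Metric.mem_closedBall.2 hzq⟩ (sub_nonneg.2 hx.2) hx.1 (by ring)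
        rw [AffineMap.lineMap_apply_module]
        exact this.1) hgen
    refine ⟨z, ?_, by rwa [dist_comm]⟩
    exact Set.mem_biUnion hb (Set.mem_biUnion ht (Set.mem_biUnion (Finset.mem_coe.2 hv)
      ⟨h1, h2, h3⟩))
  simp only [hF, Set.mem_iUnion] at haF
  obtain ⟨b, hb, t, ht, v, hv, h1, h2, h3⟩ := haF
  have hat := mem_of_mem_vertices ht ha h2
  have hav : a = v := by
    by_contra hne
    have := bary_of_ne (IsTet.of_mem ht) hat hne
    simp only [Set.mem_ofPred_eq, this] at h3
    norm_num at h3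
  exact ⟨b, hb, hav ▸ hv, h1⟩

end MeshBalls

/-! ### Counting the tetrahedra beyond the initial one. -/

/-- From e ≥ m / β and 2l + e = m² / e ≤ βm it follows that 2l ≤ βm - m / β. Here `l` will be the
remaining length, `e` the depth at the exit from the initial tetrahedron and `m` a lower bound for
circumradii. -/
theorem div_two_mul_le {β e l m : ℝ} (hβ : 0 < β) (he : 0 < e) (hm : 0 < m)
    (hm2 : m ^ 2 = e * (2 * l + e)) (hmβ : m ≤ β * e) : l / (2 * m) ≤ (β - 1 / β) / 4 := by
  have h1 : m / β ≤ e := by rw [div_le_iff₀ hβ]; linarith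
  have h2 : 2 * l + e ≤ β * m := by
    have : e * (2 * l + e) ≤ e * (β * m) := by
      rw [← hm2]
      nlinarith
    exact le_of_mul_le_mul_left this he
  rw [div_le_iff₀ (by positivity)]
  have h3 : (β - 1 / β) / 4 * (2 * m) = (β * m - m / β) / 2 := by field_simp; ring
  rw [h3]
  linarith

theorem bary_lineMap_self {b : Finset E3} (hb : IsTet b) {a : E3} (ha : a ∈ b) (q : E3) (x : ℝ) :
    bary b a (AffineMap.lineMap a q x) = 1 - x * (1 - bary b a q) := by
  rw [AffineMap.apply_lineMap, bary_self hb ha, AffineMap.lineMap_apply_ring']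
  ring

/-- If `b` contains a part of the segment from its vertex `a` to `q`, then a tetrahedron without the
vertex `a` meets the segment only behind the point in which it leaves `b`. -/
theorem one_le_mul_of_notMem {M : Geometry.SimplicialComplex ℝ E3} {b : Finset E3} {a q : E3}
    {τ : ℝ} (hb : b ∈ tetrahedra M) (hab : a ∈ b) (hτ : τ < 1)
    (hbτ : AffineMap.lineMap q a τ ∈ convexHull ℝ (b : Set E3)) :
    (∀ x, 0 ≤ x → x * (1 - bary b a q) ≤ 1 →
      AffineMap.lineMap a q x ∈ convexHull ℝ (b : Set E3)) ∧
    ∀ s ∈ tetrahedra M, a ∉ s → ∀ x, 0 ≤ x →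
      AffineMap.lineMap a q x ∈ convexHull ℝ (s : Set E3) → 1 ≤ x * (1 - bary b a q) := by
  have htet := IsTet.of_mem hb
  have hcone : ∀ x, 0 ≤ x → x * (1 - bary b a q) ≤ 1 →
      AffineMap.lineMap a q x ∈ convexHull ℝ (b : Set E3) := by
    intro x hx hxK
    rw [htet.mem_convexHull_iff]
    intro u
    by_cases hua : u = a
    · rw [hua, bary_lineMap_self htet hab]; linarith
    -- The coordinates of the other vertices are linear along the ray from `a`, so their signs at
    -- one point decide the whole ray.
    have h1 : ∀ x, bary b u (AffineMap.lineMap a q x) = x * bary b u q := by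
      intro x
      rw [AffineMap.apply_lineMap, bary_of_ne htet hab (Ne.symm hua), AffineMap.lineMap_apply_ring']
      ring
    have h2 := htet.mem_convexHull_iff.1 hbτ u
    rw [← AffineMap.lineMap_apply_one_sub, h1] at h2
    rw [h1]
    exact mul_nonneg hx (nonneg_of_mul_nonneg_right h2 (by linarith))
  refine ⟨hcone, fun s hs has x hx hxs => ?_⟩
  by_contra hlt
  push Not at hlt
  have h1 := bary_eq_bary hb hs (hcone x hx hlt.le) hxs a
  rw [bary_lineMap_self htet hab, bary_of_notMem has] at h1
  simp only [AffineMap.coe_zero, Pi.zero_apply] at h1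
  linarith

namespace MeshBalls

variable {M : Geometry.SimplicialComplex ℝ E3} {ρ : ℝ} {I O : Finset E3 → E3}
  {r R : Finset E3 → ℝ}

/-- The number of tetrahedra of circumradius at least `m` that have a point at distance at most
`l / 2` from a given point. -/
theorem card_le_of_le_R (h : MeshBalls M ρ I O r R) (hρ : 3 < ρ) {S : Finset (Finset E3)}
    (hS : ∀ s ∈ S, s ∈ tetrahedra M) {m l : ℝ} (hm : 0 < m) (hl : 0 ≤ l)
    (hmR : ∀ s ∈ S, m ≤ R s) {c : E3}
    (hc : ∀ s ∈ S, ∃ z ∈ convexHull ℝ (s : Set E3), dist z c ≤ l / 2) :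
    (S.card : ℝ) ≤ ρ ^ 3 * (l / (2 * m) + 2) ^ 3 := by
  have hρ0 : 0 < ρ := by linarith
  have hball : ∀ s : Finset E3, ∃ x : E3, s ∈ S → Metric.ball x (m / ρ) ⊆
      convexHull ℝ (s : Set E3) ∩ Metric.closedBall c (l / 2 + 2 * m) := by
    intro s
    by_cases hs : s ∈ S
    swap
    · exact ⟨0, fun h => absurd h hs⟩
    obtain ⟨z, hzs, hzc⟩ := hc s hs
    have hb := h.balls s (hS s hs)
    have hr := hb.r_pos
    have hRr := h.lt s (hS s hs)
    -- The homothety with centre `z` that shrinks the inscribed ball to radius m / ρ keeps it in `s`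
    -- and brings it within 2m of `z`, even if `s` is huge.
    set θ := m / ρ / r s with hθ
    have hθ0 : 0 < θ := by positivity
    have hθr : θ * r s = m / ρ := by rw [hθ]; field_simp
    have hθ1 : θ ≤ 1 := by
      rw [hθ, div_le_one hr, div_le_iff₀ hρ0]
      linarith [hmR s hs]
    refine ⟨AffineMap.lineMap z (I s) θ, fun _ y hy => ?_⟩
    set w : E3 := AffineMap.lineMap z y θ⁻¹ with hw
    have hyw : y = AffineMap.lineMap z w θ := by
      simp only [hw, AffineMap.lineMap_apply, vsub_eq_sub, vadd_eq_add, add_sub_cancel_right]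
      rw [smul_smul, mul_inv_cancel₀ hθ0.ne', one_smul, sub_add_cancel]
    have hwI : dist w (I s) ≤ r s := by
      have h1 : dist (AffineMap.lineMap z w θ) (AffineMap.lineMap z (I s) θ) =
          θ * dist w (I s) := by
        simp only [AffineMap.lineMap_apply, vsub_eq_sub, vadd_eq_add, dist_add_right]
        rw [dist_smul₀, Real.norm_of_nonneg hθ0.le, dist_sub_right]
      rw [Metric.mem_ball, hyw, h1, ← hθr] at hy
      exact (lt_of_mul_lt_mul_left hy hθ0.le).le
    have hws : w ∈ convexHull ℝ (s : Set E3) := hb.ball_subset hwI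
    refine ⟨?_, ?_⟩
    · rw [hyw]
      exact (convex_convexHull ℝ (s : Set E3)).lineMap_mem hzs hws ⟨hθ0.le, hθ1⟩
    · have h1 : dist y z ≤ 2 * m := by
        rw [hyw, dist_lineMap_left, Real.norm_of_nonneg hθ0.le]
        calc θ * dist z w ≤ θ * (2 * R s) := by gcongr; exact hb.dist_le_of_mem hzs hws
          _ ≤ θ * (2 * (ρ * r s)) := by gcongr
          _ = 2 * ρ * (θ * r s) := by ring
          _ = 2 * m := by rw [hθr]; field_simp
      rw [Metric.mem_closedBall]
      linarith [dist_triangle y z c]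
  choose x hx using hball
  have h1 := sum_measureReal_le (S := S) (A := fun s => Metric.ball (x s) (m / ρ))
    (B := Metric.closedBall c (l / 2 + 2 * m))
    (fun s hs t ht hst => (aedisjoint_convexHull (hS s hs) (hS t ht) hst).mono
      ((hx s hs).trans Set.inter_subset_left) ((hx t ht).trans Set.inter_subset_left))
    (fun s _ => measurableSet_ball.nullMeasurableSet)
    (fun s hs => (hx s hs).trans Set.inter_subset_right) measure_closedBall_lt_top.ne
  simp only [volume_real_ball _ (show 0 ≤ m / ρ by positivity), Finset.sum_const, nsmul_eq_mul]
    at h1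
  rw [volume_real_closedBall _ (by positivity), ← mul_assoc] at h1
  have h2 := le_of_mul_le_mul_right h1 (by positivity)
  rw [div_pow, mul_div_assoc', div_le_iff₀ (by positivity)] at h2
  calc (S.card : ℝ) = S.card * m ^ 3 / m ^ 3 := by field_simp
    _ ≤ (l / 2 + 2 * m) ^ 3 * ρ ^ 3 / m ^ 3 := by gcongr
    _ = _ := by field_simp

/-- The number of tetrahedra that are visited by the walk from an approximate nearest neighbour `a`
of `q` and of which `a` is not a vertex. -/
theorem card_le_of_notMem (h : MeshBalls M ρ I O r R) (hρ : 3 < ρ) {ε G : ℝ}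
    (hG0 : 0 < G) (hG : ε * ρ ^ 2 * G ≤ 1 / 30) (hε : ε * ρ ^ 2 ≤ 1 / 30)
    (hR : ∀ (v : E3) (s t : {s : Finset E3 // s ∈ tetrahedra M ∧ v ∈ s}),
      (vertexGraph M v).Reachable s t → R s.1 ≤ G * R t.1)
    {q a : E3} {d₀ : ℝ} (hd₀ : 0 < d₀) (hdd : d₀ ≤ dist a q) (hdε : dist a q ≤ (1 + ε) * d₀)
    (hq : ∀ v ∈ M.vertices, d₀ ≤ dist v q) (ha : a ∈ M.vertices)
    (hwalk : StarConvex ℝ q (M.space ∩ Metric.closedBall q (dist a q)))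
    {S : Finset (Finset E3)} (hS : ∀ s ∈ S, s ∈ visitedTetrahedra M a q ∧ a ∉ s) :
    (S.card : ℝ) ≤ ρ ^ 3 * ((3 * ρ / 5 - 1 / (3 * ρ / 5)) / 4 + 2) ^ 3 := by
  have hρ0 : 0 < ρ := by linarith
  have hρ2 : 9 ≤ ρ ^ 2 := by nlinarith
  have hb1 : 1 / (3 * ρ / 5) ≤ 3 * ρ / 5 := by
    rw [div_le_iff₀ (by positivity)]; nlinarith
  rcases S.eq_empty_or_nonempty with rfl | ⟨s₀, hs₀⟩
  · rw [Finset.card_empty, Nat.cast_zero]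
    have : 0 ≤ (3 * ρ / 5 - 1 / (3 * ρ / 5)) / 4 + 2 := by linarith
    positivity
  set d := dist a q with hd
  have hd0 : 0 < d := by linarith
  obtain ⟨Y, hY⟩ : ∃ Y, Y = 2 * d₀ / (64 * ρ ^ 2 + 1) := ⟨_, rfl⟩
  obtain ⟨A, hA⟩ : ∃ A, A = 2 * d₀ - Y := ⟨_, rfl⟩
  obtain ⟨τ, hτ⟩ : ∃ τ, τ = (d₀ - Y) / d := ⟨_, rfl⟩
  obtain ⟨b, hb, hab, hbτ⟩ := h.exists_initial_tetrahedron hρ hG0 hG hR hd₀ hdd hdε hY hA hτ hq ha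
    hwalk
  have hY0 : 0 < Y := by rw [hY]; positivity
  have hYA : A = 64 * ρ ^ 2 * Y := by rw [hA, hY]; field_simp; ring
  have hYd : Y < d₀ := by nlinarith
  have hA0 : 0 < A := by linarith
  have hAd : 1.6 * d₀ ≤ A := by nlinarith
  have hτ0 : 0 ≤ τ := by rw [hτ]; exact div_nonneg (by linarith) hd0.le
  have hτ1 : τ < 1 := by rw [hτ, div_lt_one hd0]; linarith
  have hτd : τ * d = d₀ - Y := by rw [hτ]; field_simp
  have htet := IsTet.of_mem hb
  have hbb := h.balls b hb
  have hRb0 := hbb.R_pos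
  have hpow : ∀ s ∈ tetrahedra M, ∀ z ∈ convexHull ℝ (s : Set E3),
      d₀ ^ 2 - dist z q ^ 2 ≤ R s ^ 2 := fun s hs z hz =>
    (h.balls s hs).sq_sub_sq_le hd₀.le (fun v hv => hq v (mem_vertices_of_mem hs hv)) hz
  have hRb : A / (8 * ρ) ≤ R b := by
    have h1 := hpow b hb _ hbτ
    rw [dist_lineMap_left, Real.norm_of_nonneg hτ0, dist_comm q a, hτd] at h1
    refine (sq_le_sq₀ (by positivity) hRb0.le).1 (le_trans (le_of_eq ?_) h1)
    have : d₀ ^ 2 - (d₀ - Y) ^ 2 = A * Y := by rw [hA]; ring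
    rw [this, hYA]; field_simp; norm_num
  set K := 1 - bary b a q with hK
  obtain ⟨hcone, hout⟩ := one_le_mul_of_notMem hb hab hτ1 hbτ
  rw [← hK] at hcone hout
  have hSx : ∀ s ∈ S, ∃ x : ℝ, 0 ≤ x ∧ x ≤ 1 ∧
      AffineMap.lineMap a q x ∈ convexHull ℝ (s : Set E3) ∧ 1 ≤ x * K := by
    intro s hs
    obtain ⟨⟨hsT, z, hzseg, hzs⟩, has⟩ := hS s hs
    rw [segment_eq_image_lineMap] at hzseg
    obtain ⟨x, hx, rfl⟩ := hzseg
    exact ⟨x, hx.1, hx.2, hzs, hout s hsT has x hx.1 hzs⟩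
  obtain ⟨x₀, hx₀, hx₀1, -, hx₀K⟩ := hSx s₀ hs₀
  have hK0 : 0 < K := by
    by_contra hK
    push Not at hK
    nlinarith
  have hK1 : 1 ≤ K := by nlinarith
  -- The parameter at which the walk leaves `b` through the face opposite to `a`.
  set y := 1 / K with hy
  have hyK : y * K = 1 := by rw [hy]; field_simp
  have hy0 : 0 < y := by positivity
  have hy1 : y ≤ 1 := by rw [hy, div_le_one hK0]; exact hK1
  have hSy : ∀ s ∈ S, ∃ x : ℝ, y ≤ x ∧ x ≤ 1 ∧
      AffineMap.lineMap a q x ∈ convexHull ℝ (s : Set E3) := by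
    intro s hs
    obtain ⟨x, -, hx1, hxs, hxK⟩ := hSx s hs
    exact ⟨x, by rw [hy, div_le_iff₀ hK0]; exact hxK, hx1, hxs⟩
  have hyb := hcone y hy0.le hyK.le
  have hdist : ∀ x : ℝ, x ≤ 1 → dist (AffineMap.lineMap a q x) q = (1 - x) * d := by
    intro x hx
    rw [dist_lineMap_right, Real.norm_of_nonneg (by linarith)]
  have hre : 2 * r b ≤ y * d := by
    have h1 := hbb.bary_sub_le a a (AffineMap.lineMap a q y)
    rw [bary_lineMap_self htet hab, ← hK, hyK, bary_self htet hab, dist_left_lineMap, Real.norm_of_nonneg hy0.le,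
      le_div_iff₀ (by linarith [hbb.r_pos])] at h1
    linarith
  have hRr := h.lt b hb
  -- The walk crosses `b` between `a` and the opposite face, hence y d ≥ 2 r b ≥ A / (4ρ²) ≥ 0.4 d₀
  -- / ρ², whereas d - d₀ ≤ εd₀ ≤ d₀ / (30ρ²).
  have hδ : 12 * (d - d₀) ≤ y * d := by
    have h1 : A ≤ 4 * ρ ^ 2 * (y * d) := by
      rw [div_le_iff₀ (by positivity)] at hRb
      nlinarith [mul_le_mul_of_nonneg_left hre (show 0 ≤ ρ by linarith)]
    have h2 : ρ ^ 2 * (12 * (d - d₀)) ≤ ρ ^ 2 * (y * d) := by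
      have h3 : ρ ^ 2 * (12 * (d - d₀)) ≤ 12 * (ε * ρ ^ 2 * d₀) := by nlinarith
      have h4 : ε * ρ ^ 2 * d₀ ≤ 1 / 30 * d₀ := by gcongr
      linarith
    exact le_of_mul_le_mul_left h2 (by positivity)
  set e := y * d - (d - d₀) with he
  set l := (1 - y) * d with hl
  have hyd : 0 < y * d := by positivity
  have he0 : 0 < e := by linarith
  have hl0 : 0 ≤ l := mul_nonneg (by linarith) hd0.le
  have hel : d₀ = l + e := by rw [he, hl]; ring
  set m := Real.sqrt (e * (2 * l + e)) with hm
  have hm2 : m ^ 2 = e * (2 * l + e) := Real.sq_sqrt (by positivity)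
  have hm0 : 0 < m := Real.sqrt_pos.2 (by positivity)
  have hmR : ∀ s ∈ tetrahedra M, ∀ x, y ≤ x → x ≤ 1 →
      AffineMap.lineMap a q x ∈ convexHull ℝ (s : Set E3) → m ≤ R s := by
    intro s hs x hyx hx hxs
    refine Real.sqrt_le_iff.2 ⟨(h.balls s hs).R_pos.le, le_trans ?_ (hpow s hs _ hxs)⟩
    rw [hdist x hx]
    have h1 : ((1 - x) * d) ^ 2 ≤ l ^ 2 :=
      pow_le_pow_left₀ (mul_nonneg (by linarith) hd0.le) (by rw [hl]; gcongr) 2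
    have h2 : d₀ ^ 2 = l ^ 2 + e * (2 * l + e) := by rw [hel]; ring
    linarith
  -- The exit point belongs to `b`, so m ≤ R b ≤ ρ y d / 2, and e ≥ 11/12 y d. The resulting factor
  -- 6/11 is rounded up to 3/5.
  have hmb : m ≤ 3 * ρ / 5 * e := by
    refine (hmR b hb y le_rfl hy1 hyb).trans (hRr.le.trans ?_)
    have : ρ * (2 * r b) ≤ ρ * (y * d) := by gcongr
    have : ρ * (11 / 12 * (y * d)) ≤ ρ * e := by gcongr; linarith
    have : 0 < ρ * (y * d) := by positivity
    linarith
  have hlm : l / (2 * m) ≤ (3 * ρ / 5 - 1 / (3 * ρ / 5)) / 4 := by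
    exact div_two_mul_le (by positivity) he0 hm0 hm2 hmb
  refine (h.card_le_of_le_R hρ (fun s hs => (hS s hs).1.1) hm0 hl0 (fun s hs => ?_)
    (c := AffineMap.lineMap a q ((1 + y) / 2)) (fun s hs => ?_)).trans ?_
  · obtain ⟨x, h1, h2, h3⟩ := hSy s hs
    exact hmR s (hS s hs).1.1 x h1 h2 h3
  · obtain ⟨x, h1, h2, h3⟩ := hSy s hs
    refine ⟨_, h3, ?_⟩
    rw [dist_lineMap_lineMap, Real.dist_eq]
    have : |x - (1 + y) / 2| ≤ (1 - y) / 2 := by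
      rw [abs_le]; constructor <;> linarith
    calc _ ≤ (1 - y) / 2 * d := by gcongr
      _ = _ := by rw [hl]; ring
  · gcongr

end MeshBalls

/-! ### Numerical comparison and conclusion. -/

theorem walk_bound_le {ρ : ℝ} (hρ : 3 < ρ) :
    24 * ρ ^ 2 - 24 * ρ + 8 + ρ ^ 3 * ((3 * ρ / 5 - 1 / (3 * ρ / 5)) / 4 + 2) ^ 3 ≤
      Real.sqrt 3 * Real.pi / 486 * ρ ^ 3 * (ρ ^ 2 + 3) ^ 3 := by
  have hρ0 : 0 < ρ := by linarith
  have hs : 1.732 ≤ Real.sqrt 3 := Real.le_sqrt_of_sq_le (by norm_num)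
  have hπ := Real.pi_gt_d2
  have hc : 5.43 / 486 ≤ Real.sqrt 3 * Real.pi / 486 := by
    gcongr
    nlinarith
  have hb : 1 / (3 * ρ / 5) ≤ 3 * ρ / 5 := by
    rw [div_le_iff₀ (by positivity)]; nlinarith
  have h1 : (3 * ρ / 5 - 1 / (3 * ρ / 5)) / 4 + 2 ≤ 2.33 * ((ρ ^ 2 + 3) / 12) := by
    -- The tangent to 5 / (3ρ) at ρ = 3 lies below this convex function.
    have h2 : 10 / 9 - ρ * (5 / 27) ≤ 1 / (3 * ρ / 5) := by
      rw [le_div_iff₀ (by positivity)]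
      nlinarith [sq_nonneg (ρ - 3)]
    nlinarith
  have h2 : ((3 * ρ / 5 - 1 / (3 * ρ / 5)) / 4 + 2) ^ 3 ≤ (2.33 * ((ρ ^ 2 + 3) / 12)) ^ 3 :=
    pow_le_pow_left₀ (by linarith) h1 3
  set T := (ρ ^ 2 + 3) / 12 with hT
  have hT1 : 1 ≤ T := by rw [hT]; nlinarith
  have hT3 : 1 ≤ T ^ 3 := one_le_pow₀ hT1
  have h3 : 24 * ρ ^ 2 - 24 * ρ + 8 ≤ 6 * ρ ^ 3 := by nlinarith [mul_pos hρ0 hρ0]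
  have h4 : (ρ ^ 2 + 3) ^ 3 = 1728 * T ^ 3 := by rw [hT]; ring
  have hρ3 : 0 < ρ ^ 3 := by positivity
  calc _ ≤ 6 * ρ ^ 3 * T ^ 3 + ρ ^ 3 * (2.33 * T) ^ 3 := by
        gcongr
        exact h3.trans (le_mul_of_one_le_right (by positivity) hT3)
    _ = (6 + 2.33 ^ 3) * (ρ ^ 3 * T ^ 3) := by ring
    _ ≤ 5.43 / 486 * 1728 * (ρ ^ 3 * T ^ 3) := by gcongr; norm_num
    _ ≤ Real.sqrt 3 * Real.pi / 486 * 1728 * (ρ ^ 3 * T ^ 3) := by gcongr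
    _ = _ := by rw [h4]; ring

theorem mainTheorem10
    (M : Geometry.SimplicialComplex ℝ E3) (hM : IsTetrahedralMesh M)
    (ρ : ℝ) (hρ : WellShaped M ρ)
    (Ω : ℝ)
    (hΩ : (0 < Ω ∧ ∀ t : Affine.Simplex ℝ E3 3, IsTetrahedronOf t M →
              ∀ i : Fin 4, Ω ≤ solidAngle t i) ∨
          Ω = 2 * Real.arcsin (3 * Real.sqrt 3 / (8 * ρ ^ 2)))
    (ε : ℝ) (hε₀ : 0 ≤ ε)
    (hε : ε < 1 / (ρ ^ 2 + 1) * (1 / ρ) ^ (⌊2 * Real.pi / Ω⌋₊ + 3))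
    (q p' : E3)
    (hp' : IsApproxNearestNeighbour M.vertices ε q p')
    (hwalk : StarConvex ℝ q (M.space ∩ Metric.closedBall q (dist p' q))) :
    ((visitedTetrahedra M p' q).ncard : ℝ) ≤
      Real.sqrt 3 * Real.pi / 486 * ρ ^ 3 * (ρ ^ 2 + 3) ^ 3 + (⌊2 * Real.pi / Ω⌋₊ : ℝ) := by
  classical
  obtain ⟨I, O, r, R, h⟩ := hρ.exists_meshBalls hM
  obtain ⟨hp'M, p, ⟨hpM, hp⟩, hdε⟩ := hp'
  obtain ⟨s, hs, -⟩ := hM.exists_tetrahedron_superset (f := {p'}) hp'M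
  have hρ3 : 3 < ρ := h.three_lt hs
  obtain ⟨G, hG0, hG, hR⟩ := h.exists_growth hρ3 hΩ hε₀ hε
  have hερ : ε * ρ ^ 2 ≤ 1 / 30 := by
    have h1 : (1 / ρ) ^ (⌊2 * Real.pi / Ω⌋₊ + 3) ≤ (1 / ρ) ^ 3 :=
      pow_le_pow_of_le_one (by positivity) (by rw [div_le_one (by linarith)]; linarith) (by omega)
    have h2 : ε ≤ 1 / (ρ ^ 2 + 1) * (1 / ρ) ^ 3 := hε.le.trans (by gcongr)
    calc ε * ρ ^ 2 ≤ 1 / (ρ ^ 2 + 1) * (1 / ρ) ^ 3 * ρ ^ 2 := by gcongr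
      _ = 1 / ((ρ ^ 2 + 1) * ρ) := by field_simp
      _ ≤ 1 / 30 := by gcongr; nlinarith
  have hfin : (visitedTetrahedra M p' q).Finite := hM.finite_tetrahedra.subset fun _ hs => hs.1
  set V := hfin.toFinset with hV
  have hmemV : ∀ s, s ∈ V ↔ s ∈ visitedTetrahedra M p' q := fun s => hfin.mem_toFinset
  have h1 : ((V.filter fun s => p' ∈ s).card : ℝ) ≤ 24 * ρ ^ 2 - 24 * ρ + 8 :=
    h.card_le_of_mem hρ3 (v := p') fun s hs => by
      rw [Finset.mem_filter, hmemV] at hs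
      exact ⟨hs.1.1, hs.2⟩
  have h2 : ((V.filter fun s => p' ∉ s).card : ℝ) ≤
      ρ ^ 3 * ((3 * ρ / 5 - 1 / (3 * ρ / 5)) / 4 + 2) ^ 3 := by
    -- If `q` is a vertex, then `p' = q`, the walk is a single point, and every tetrahedron
    -- containing it has it as a vertex.
    rcases (dist_nonneg (x := p) (y := q)).eq_or_lt with hd | hd
    · have hpq : p' = q := by
        rw [← hd, mul_zero] at hdε
        exact dist_le_zero.1 hdε
      have hempty : V.filter (fun s => p' ∉ s) = ∅ := by
        rw [Finset.filter_eq_empty_iff]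
        intro s hs
        obtain ⟨hsT, z, hz, hzs⟩ := (hmemV s).1 hs
        rw [← hpq, segment_same, Set.mem_singleton_iff] at hz
        exact not_not.2 (mem_of_mem_vertices hsT hp'M (hz ▸ hzs))
      rw [hempty, Finset.card_empty, Nat.cast_zero]
      have : 1 / (3 * ρ / 5) ≤ 3 * ρ / 5 := by
        rw [div_le_iff₀ (by positivity)]; nlinarith
      have : 0 ≤ (3 * ρ / 5 - 1 / (3 * ρ / 5)) / 4 + 2 := by linarith
      positivity
    · exact h.card_le_of_notMem hρ3 hG0 hG hερ hR hd (hp p' hp'M) hdε hp hp'M hwalk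
        fun s hs => by
          rw [Finset.mem_filter, hmemV] at hs
          exact hs
  have h3 : ((visitedTetrahedra M p' q).ncard : ℝ) =
      (V.filter fun s => p' ∈ s).card + (V.filter fun s => p' ∉ s).card := by
    rw [Set.ncard_eq_toFinset_card _ hfin]
    exact_mod_cast (Finset.card_filter_add_card_filter_not (s := V) (fun s => p' ∈ s)).symm
  have h4 := walk_bound_le hρ3
  have h5 : (0 : ℝ) ≤ (⌊2 * Real.pi / Ω⌋₊ : ℝ) := Nat.cast_nonneg _
  rw [h3]
  linarith
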